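/- Consider a recommender that serves users arriving one after another, with two categories $a\in\{1,2\}$ and two user types $x$. An instance consists of click probabilities $\mathbf P_{a,x}\in(0,1)$ and a prior $\mathbf q$ on the types. Users are independent; each has a type drawn from $\mathbf q$, hidden from the learner. In every iteration a category is recommended to the current user; a user of type $x$ clicks on category $a$ with probability $\mathbf P_{a,x}$, independently across iterations given her type. She stays after a click and departs at her first no-click. A (deterministic) policy maps the history of interactions with the current user to the next category. Its return $V^\pi$ is the number of clicks collected until the user departs, and $\pi^*$ is optimal if it maximizes $\mathbb E[V^\pi]$ over all policies. Let $\varepsilon\in(0,1)$ be known to the learner, and consider the instances with $\max_{a,x}\mathbf P_{a,x}\le 1-\varepsilon$. For $a\in\{1,2\}$ and $h\ge 0$, the $(a,h)$-threshold policy recommends $a$ in the first $h$ iterations and the other category forever after. Let $\Pi_H$ be the set of the $2H+2$ such policies with $0\le h\le H$. The algorithm UCB-Hybrid with input $(\Pi,T,\tilde\tau,\eta)$ executes on each user $t=1,\dots,T$ a policy $\pi_t\in\Pi$ with maximal index, ties being broken in any way as a function of the previously selected policies and received returns. The index of $\pi$ is $\infty$ if $\pi$ has not been executed before. If $\pi$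 has been executed $n\ge1$ times, with average return $\bar V$, the index is $\bar V+\frac{8\sqrt\eta\,\tilde\tau\ln T}{n}$ when $n<8\eta\ln T$, and $\bar V+\sqrt{8\tilde\tau^2\ln T/n}$ otherwise. Take $\tilde\tau=8e/\ln\frac1{1-\varepsilon}$ and $\eta=1$, and let $R_T=T\,\mathbb E[V^{\pi^*}]-\sum_{t=1}^T V^{\pi_t}$ be the regret of UCB-Hybrid run with $(\Pi_H,T,\tilde\tau,\eta)$, where $H=H(T)$. Then all returns are integrable, an optimal policy exists on each of these instances, and the following hold for every $H:\mathbb N\to\mathbb N$ with $H(T)=\Theta(\ln T)$, where $R_T$ is always integrable: 1. If $H(T)\ge \frac{\ln T}{2\ln(1/(1-\varepsilon))}$ for all large $T$, then there is a constant $C$, depending only on $\varepsilon$ and the function $H$, such that $\mathbb E[R_T]\le C\sqrt T\ln T$ for all $T\ge2$, all such instances and all tie-breaking rules. 2. Without this lower bound on $H$, for each such instance there is a constant $C$, depending on $\varepsilon$, the function $H$ and the instance, such that $\mathbb E[R_T]\le C\sqrt T\ln T$ for all $T\ge2$ and all tie-breaking rules. -/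

import Mathlib

open MeasureTheory ProbabilityTheory Filter Asymptotics

noncomputable section

namespace DepartingBandits

/-- The two categories. -/
abbrev Category := Fin 2

/-- The two user types. -/
abbrev UserType := Fin 2

/-- An instance with two user types and two categories: click probabilities `P a x ∈ (0,1)` and a
prior `q` over the user types.  (A user departs after her first no-click, so there are no further
departure parameters.) -/
structure BanditInstance where
  P : Category → UserType → ℝ
  P_pos : ∀ a x, 0 < P a x
  P_lt_one : ∀ a x, P a x < 1
  q : UserType → ℝ
  q_nonneg : ∀ x, 0 ≤ q x
  q_sum : ∑ x, q x = 1

/-- The potential clicks of one user: entry `(j, a)` tells whether the user clicks if category `a`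
is recommended to her in her iteration `j` (iterations are numbered from `0`). -/
abbrev ClickTable := ℕ × Category → Bool

/-- The click table of a user of type `x`: independent entries, entry `(j, a)` being `true` with
probability `P a x`. -/
def clickLaw (I : BanditInstance) (x : UserType) : Measure ClickTable :=
  Measure.infinitePi fun e : ℕ × Category =>
    bernoulliMeasure true false ⟨I.P e.2 x, (I.P_pos e.2 x).le, (I.P_lt_one e.2 x).le⟩

instance (I : BanditInstance) (x : UserType) : IsProbabilityMeasure (clickLaw I x) := by
  unfold clickLaw; infer_instance

/-- The law of one user: her type is drawn from the prior, and given the type her clicks are drawn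
from `clickLaw`. -/
def userLaw (I : BanditInstance) : Measure (UserType × ClickTable) :=
  ∑ x, ENNReal.ofReal (I.q x) • (Measure.dirac x).prod (clickLaw I x)

instance (I : BanditInstance) : IsProbabilityMeasure (userLaw I) := by
  constructor
  have h : ENNReal.ofReal (I.q 0) + ENNReal.ofReal (I.q 1) = 1 := by
    rw [← ENNReal.ofReal_add (I.q_nonneg 0) (I.q_nonneg 1), ← Fin.sum_univ_two, I.q_sum,
      ENNReal.ofReal_one]
  simp [userLaw, Fin.sum_univ_two, h]

/-- The law of the stream of users `0, 1, 2, …`, which are independent and identically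
distributed. -/
def streamLaw (I : BanditInstance) : Measure (ℕ → UserType × ClickTable) :=
  Measure.infinitePi fun _ : ℕ => userLaw I

/-- A policy maps the history of interactions with the current user (the recommended categories
together with the observed clicks, the most recent one first) to the next category. -/
abbrev Policy := List (Category × Bool) → Category

/-- The history after `j` iterations of `π` with a user with click table `r`. -/
def userHistory (π : Policy) (r : ClickTable) : ℕ → List (Category × Bool)
  | 0 => []
  | j + 1 => (π (userHistory π r j), r (j, π (userHistory π r j))) :: userHistory π r j

/-- Whether the category that `π` recommends in iteration `j` is clicked. -/
def clicked (π : Policy) (r : ClickTable) (j : ℕ) : Bool :=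
  r (j, π (userHistory π r j))

/-- The number of iterations until the user departs, which she does at her first no-click (the
last iteration is counted).  The value is `0` in the event, of probability zero, that she never
departs. -/
def episodeLength (π : Policy) (r : ClickTable) : ℕ :=
  sInf {n | ∃ j, n = j + 1 ∧ clicked π r j = false}

/-- The return of `π`: the sum of the rewards (`1` for a click, `0` for a no-click) over all the
iterations until the user departs. -/
def policyReturn (π : Policy) (r : ClickTable) : ℕ :=
  ∑ j ∈ Finset.range (episodeLength π r), if clicked π r j then 1 else 0

/-- The expected return of a policy. -/
def expectedReturn (I : BanditInstance) (π : Policy) : ℝ :=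
  ∫ u, (policyReturn π u.2 : ℝ) ∂(userLaw I)

/-- A policy is optimal if it maximizes the expected return among all policies. -/
def IsOptimal (I : BanditInstance) (π : Policy) : Prop :=
  ∀ π' : Policy, expectedReturn I π' ≤ expectedReturn I π

/-- The `(a, h)`-threshold policy: category `a` in the first `h` iterations, then the other
category `1 - a` forever. -/
def thresholdPolicy (a : Category) (h : ℕ) : Policy :=
  fun hist => if hist.length < h then a else 1 - a

/-- The `2 * H + 2` threshold policies with threshold at most `H`. -/
def thresholdFamily (H : ℕ) : Category × Fin (H + 1) → Policy :=
  fun i => thresholdPolicy i.1 i.2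

section UCB

variable {ι : Type} [DecidableEq ι]

/-- How many times arm `i` was selected.  A history of the learner lists, for the users so far
(the most recent one first), the selected arm and the return received. -/
def pulls (h : List (ι × ℕ)) (i : ι) : ℕ :=
  (h.filter fun e => e.1 = i).length

/-- The sum of the returns received from arm `i`. -/
def returnSum (h : List (ι × ℕ)) (i : ι) : ℕ :=
  ((h.filter fun e => e.1 = i).map Prod.snd).sum

/-- The upper confidence bound with hybrid radius of arm `i` after history `h`. -/
def ucbIndex (T : ℕ) (τ η : ℝ) (h : List (ι × ℕ)) (i : ι) : EReal :=
  if pulls h i = 0 then ⊤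
  else if (pulls h i : ℝ) < 8 * η * Real.log T then
    (((returnSum h i : ℝ) / pulls h i
      + 8 * Real.sqrt η * τ * Real.log T / pulls h i : ℝ) : EReal)
  else
    (((returnSum h i : ℝ) / pulls h i
      + Real.sqrt (8 * τ ^ 2 * Real.log T / pulls h i) : ℝ) : EReal)

/-- `sel` is a selection rule of UCB-Hybrid with parameters `T, τ, η`: after every history it
selects an arm with maximal upper confidence bound (ties are broken arbitrarily). -/
def IsUCBHybrid (T : ℕ) (τ η : ℝ) (sel : List (ι × ℕ) → ι) : Prop :=
  ∀ h i, ucbIndex T τ η h i ≤ ucbIndex T τ η h (sel h)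

/-- The learner's history after `t` users, when arm `i` stands for the policy `Pol i`. -/
def runHistory (Pol : ι → Policy) (sel : List (ι × ℕ) → ι)
    (ω : ℕ → UserType × ClickTable) : ℕ → List (ι × ℕ)
  | 0 => []
  | t + 1 =>
    (sel (runHistory Pol sel ω t),
      policyReturn (Pol (sel (runHistory Pol sel ω t))) (ω t).2) :: runHistory Pol sel ω t

/-- The policy executed on user `t`. -/
def selectedPolicy (Pol : ι → Policy) (sel : List (ι × ℕ) → ι)
    (ω : ℕ → UserType × ClickTable) (t : ℕ) : Policy :=
  Pol (sel (runHistory Pol sel ω t))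

/-- The regret for `T` users against the policy `πstar` (meant to be optimal): `T` times the
expected return of `πstar` minus the sum of the returns obtained from the `T` users. -/
def regret (I : BanditInstance) (πstar : Policy) (Pol : ι → Policy) (sel : List (ι × ℕ) → ι)
    (T : ℕ) (ω : ℕ → UserType × ClickTable) : ℝ :=
  T * expectedReturn I πstar
    - ∑ t ∈ Finset.range T, (policyReturn (selectedPolicy Pol sel ω t) (ω t).2 : ℝ)

end UCB

/-- The parameter `8e / ln (1 / (1 - ε))`. -/
def tauTilde (ε : ℝ) : ℝ := 8 * Real.exp 1 / Real.log (1 / (1 - ε))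

end DepartingBandits

end

namespace DepartingBandits

/-- The history of a user who clicked in each of her first `j` iterations under `π`. -/
def clickHistory (π : Policy) : ℕ → List (Category × Bool)
  | 0 => []
  | j + 1 => (π (clickHistory π j), true) :: clickHistory π j

/-- The category that `π` recommends in iteration `j` to a user who has always clicked. -/
def clickPath (π : Policy) (j : ℕ) : Category := π (clickHistory π j)

theorem clickHistory_length (π : Policy) (j : ℕ) : (clickHistory π j).length = j := by
  induction j with
  | zero => rfl
  | succ j ih => simp [clickHistory, ih]

theorem userHistory_eq_clickHistory {π : Policy} {r : ClickTable} {n : ℕ}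
    (h : ∀ j < n, clicked π r j = true) : userHistory π r n = clickHistory π n := by
  induction n with
  | zero => rfl
  | succ n ih =>
    have h1 := ih fun j hj => h j (hj.trans n.lt_succ_self)
    have h2 := h n n.lt_succ_self
    simp only [clicked, h1] at h2
    simp [userHistory, clickHistory, h1, h2]

theorem userHistory_eq_clickHistory' {π : Policy} {r : ClickTable} {n : ℕ}
    (h : ∀ j < n, r (j, clickPath π j) = true) : userHistory π r n = clickHistory π n := by
  induction n with
  | zero => rfl
  | succ n ih =>
    have h1 := ih fun j hj => h j (hj.trans n.lt_succ_self)
    have h2 := h n n.lt_succ_self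
    simp only [clickPath] at h2
    simp [userHistory, clickHistory, h1, h2]

theorem forall_clicked_iff {π : Policy} {r : ClickTable} {n : ℕ} :
    (∀ j < n, clicked π r j = true) ↔ ∀ j < n, r (j, clickPath π j) = true := by
  constructor
  · intro h j hj
    have := h j hj
    rwa [clicked, userHistory_eq_clickHistory fun i hi => h i (hi.trans hj)] at this
  · intro h j hj
    have := h j hj
    rwa [clicked, userHistory_eq_clickHistory' fun i hi => h i (hi.trans hj)]

theorem succ_le_policyReturn_iff {π : Policy} {r : ClickTable} {n : ℕ} :
    n + 1 ≤ policyReturn π r ↔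
      (∀ j < n + 1, r (j, clickPath π j) = true) ∧ ¬ ∀ j, r (j, clickPath π j) = true := by
  have hall : (∀ j, r (j, clickPath π j) = true) ↔ ∀ j, clicked π r j = true :=
    ⟨fun h j => forall_clicked_iff.2 (fun i _ => h i) j j.lt_succ_self,
      fun h j => forall_clicked_iff.1 (fun i _ => h i) j j.lt_succ_self⟩
  rw [hall, ← forall_clicked_iff]
  by_cases hex : ∀ j, clicked π r j = true
  · have : episodeLength π r = 0 := by
      have : {n | ∃ j, n = j + 1 ∧ clicked π r j = false} = ∅ := by
        ext; simp [hex]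
      simp [episodeLength, this]
    simp [policyReturn, this, hex]
  · have hex' : ∃ j, clicked π r j = false := by simpa using hex
    classical
    set N := Nat.find hex' with hN
    have hNf : clicked π r N = false := Nat.find_spec hex'
    have hlt : ∀ j < N, clicked π r j = true := fun j hj => by simpa using Nat.find_min hex' hj
    have hlen : episodeLength π r = N + 1 := by
      refine le_antisymm (Nat.sInf_le ⟨N, rfl, hNf⟩) (le_csInf ⟨N + 1, N, rfl, hNf⟩ ?_)
      rintro _ ⟨j, rfl, hj⟩
      exact Nat.succ_le_succ (Nat.find_min' hex' hj)
    have hret : policyReturn π r = N := by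
      rw [policyReturn, hlen, Finset.sum_range_succ, hNf,
        Finset.sum_congr rfl fun j hj => if_pos (hlt j (Finset.mem_range.1 hj))]
      simp
    rw [hret]
    simp only [hex, not_false_eq_true, and_true]
    exact ⟨fun h j hj => hlt j (by omega), fun h => by
      by_contra hc
      have := h N (by omega)
      simp [hNf] at this⟩

theorem measurableSet_clicks (σ : ℕ → Category) (n : ℕ) :
    MeasurableSet {r : ClickTable | ∀ j < n, r (j, σ j) = true} := by
  have : {r : ClickTable | ∀ j < n, r (j, σ j) = true}
      = ⋂ j, ⋂ (_ : j < n), (fun r : ClickTable => r (j, σ j)) ⁻¹' {true} := by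
    ext; simp
  rw [this]
  exact MeasurableSet.iInter fun j => MeasurableSet.iInter fun _ =>
    measurable_pi_apply _ (measurableSet_singleton _)

theorem measurableSet_clicks_forall (σ : ℕ → Category) :
    MeasurableSet {r : ClickTable | ∀ j, r (j, σ j) = true} := by
  have : {r : ClickTable | ∀ j, r (j, σ j) = true}
      = ⋂ j, (fun r : ClickTable => r (j, σ j)) ⁻¹' {true} := by
    ext; simp
  rw [this]
  exact MeasurableSet.iInter fun j => measurable_pi_apply _ (measurableSet_singleton _)

theorem measurable_policyReturn (π : Policy) : Measurable (policyReturn π) := by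
  refine measurable_of_Ici fun n => ?_
  cases n with
  | zero => simp
  | succ n =>
    have : policyReturn π ⁻¹' Set.Ici (n + 1)
        = {r | ∀ j < n + 1, r (j, clickPath π j) = true} \ {r | ∀ j, r (j, clickPath π j) = true} := by
      ext r; simp only [Set.mem_preimage, Set.mem_Ici, succ_le_policyReturn_iff]; rfl
    rw [this]
    exact (measurableSet_clicks _ _).diff (measurableSet_clicks_forall _)

theorem measurable_userReturn (π : Policy) :
    Measurable fun u : UserType × ClickTable => policyReturn π u.2 :=
  (measurable_policyReturn π).comp measurable_snd

theorem clickLaw_clicks (I : BanditInstance) (x : UserType) (σ : ℕ → Category) (n : ℕ) :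
    clickLaw I x {r | ∀ j < n, r (j, σ j) = true}
      = ENNReal.ofReal (∏ j ∈ Finset.range n, I.P (σ j) x) := by
  classical
  have hinj : Function.Injective fun j : ℕ => (j, σ j) := fun i j h => (Prod.ext_iff.1 h).1
  have hset : {r : ClickTable | ∀ j < n, r (j, σ j) = true}
      = Set.pi ((Finset.range n).image fun j => (j, σ j) : Finset (ℕ × Category))
          fun _ => {true} := by
    ext r; simp [Set.mem_pi]
  rw [hset, clickLaw, Measure.infinitePi_pi _ (fun _ _ => measurableSet_singleton _),
    Finset.prod_image hinj.injOn, ENNReal.ofReal_prod_of_nonneg fun j _ => (I.P_pos _ _).le]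
  refine Finset.prod_congr rfl fun j _ => ?_
  rw [bernoulliMeasure_apply_of_mem_of_notMem _ (measurableSet_singleton _) rfl (by simp)]
  rw [ENNReal.ofReal]
  congr 1
  ext
  simp [(I.P_pos (σ j) x).le]

theorem clickLaw_clicks_forall (I : BanditInstance) (x : UserType) (σ : ℕ → Category) :
    clickLaw I x {r | ∀ j, r (j, σ j) = true} = 0 := by
  set m := max (I.P 0 x) (I.P 1 x) with hm
  have hm0 : 0 ≤ m := (I.P_pos 0 x).le.trans (le_max_left _ _)
  have hm1 : m < 1 := max_lt (I.P_lt_one 0 x) (I.P_lt_one 1 x)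
  have hle : ∀ a, I.P a x ≤ m := by
    intro a; fin_cases a
    · exact le_max_left _ _
    · exact le_max_right _ _
  have hlim : Tendsto (fun n : ℕ => ENNReal.ofReal (m ^ n)) atTop (nhds 0) := by
    simpa using ENNReal.tendsto_ofReal (tendsto_pow_atTop_nhds_zero_of_lt_one hm0 hm1)
  refine le_antisymm (ge_of_tendsto' hlim fun n => ?_) bot_le
  calc clickLaw I x {r | ∀ j, r (j, σ j) = true}
      ≤ clickLaw I x {r | ∀ j < n, r (j, σ j) = true} := measure_mono fun r hr j _ => hr j
    _ = ENNReal.ofReal (∏ j ∈ Finset.range n, I.P (σ j) x) := clickLaw_clicks I x σ n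
    _ ≤ ENNReal.ofReal (m ^ n) := by
      refine ENNReal.ofReal_le_ofReal ?_
      calc _ ≤ ∏ j ∈ Finset.range n, m :=
            Finset.prod_le_prod (fun _ _ => (I.P_pos _ _).le) fun _ _ => hle _
        _ = _ := by simp

theorem userLaw_succ_le_policyReturn (I : BanditInstance) (π : Policy) (n : ℕ) :
    userLaw I {u | n + 1 ≤ policyReturn π u.2}
      = ENNReal.ofReal (∑ x, I.q x * ∏ j ∈ Finset.range (n + 1), I.P (clickPath π j) x) := by
  have hmeas : MeasurableSet {r | n + 1 ≤ policyReturn π r} :=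
    measurable_policyReturn π measurableSet_Ici
  have hcl : ∀ x, clickLaw I x {r | n + 1 ≤ policyReturn π r}
      = ENNReal.ofReal (∏ j ∈ Finset.range (n + 1), I.P (clickPath π j) x) := by
    intro x
    have : {r | n + 1 ≤ policyReturn π r}
        = {r | ∀ j < n + 1, r (j, clickPath π j) = true} \ {r | ∀ j, r (j, clickPath π j) = true} := by
      ext r; simp only [Set.mem_ofPred_eq, succ_le_policyReturn_iff]; rfl
    rw [this, measure_sdiff_null (clickLaw_clicks_forall I x _), clickLaw_clicks]
  have hset : {u : UserType × ClickTable | n + 1 ≤ policyReturn π u.2}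
      = Set.univ ×ˢ {r | n + 1 ≤ policyReturn π r} := by ext; simp
  rw [userLaw, Measure.finsetSum_apply, ENNReal.ofReal_sum_of_nonneg fun x _ =>
    mul_nonneg (I.q_nonneg x) (Finset.prod_nonneg fun _ _ => (I.P_pos _ _).le)]
  refine Finset.sum_congr rfl fun x _ => ?_
  rw [Measure.smul_apply, hset, Measure.prod_prod, hcl, measure_univ, one_mul, smul_eq_mul,
    ENNReal.ofReal_mul (I.q_nonneg x)]

theorem userLaw_tail_le (I : BanditInstance) {r : ℝ} (hr : ∀ a x, I.P a x ≤ r) (π : Policy)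
    (n : ℕ) : userLaw I {u | n + 1 ≤ policyReturn π u.2} ≤ ENNReal.ofReal (r ^ (n + 1)) := by
  rw [userLaw_succ_le_policyReturn]
  refine ENNReal.ofReal_le_ofReal ?_
  calc _ ≤ ∑ x, I.q x * r ^ (n + 1) := by
        refine Finset.sum_le_sum fun x _ => mul_le_mul_of_nonneg_left ?_ (I.q_nonneg x)
        calc _ ≤ ∏ j ∈ Finset.range (n + 1), r :=
              Finset.prod_le_prod (fun _ _ => (I.P_pos _ _).le) fun _ _ => hr _ _
          _ = _ := by simp
    _ = r ^ (n + 1) := by rw [← Finset.sum_mul, I.q_sum, one_mul]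

theorem lintegral_sum_range {α : Type*} [MeasurableSpace α] (μ : Measure α) {X : α → ℕ}
    (hX : Measurable X) (d : ℕ → ENNReal) :
    ∫⁻ u, ∑ n ∈ Finset.range (X u), d n ∂μ = ∑' n, d n * μ {u | n + 1 ≤ X u} := by
  have hms : ∀ n, MeasurableSet {u | n + 1 ≤ X u} := fun n => hX measurableSet_Ici
  have h : ∀ u, ∑ n ∈ Finset.range (X u), d n
      = ∑' n, Set.indicator {u | n + 1 ≤ X u} (fun _ => d n) u := by
    intro u
    rw [tsum_eq_sum (s := Finset.range (X u))]
    · refine Finset.sum_congr rfl fun n hn => ?_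
      rw [Set.indicator_of_mem]
      exact Finset.mem_range.1 hn
    · intro n hn
      rw [Set.indicator_of_notMem]
      simpa using hn
  simp_rw [h]
  rw [lintegral_tsum fun n => (measurable_const.indicator (hms n)).aemeasurable]
  simp_rw [lintegral_indicator_const (hms _)]

section SubExponential

variable {α : Type*} [MeasurableSpace α] {μ : Measure α} {X : α → ℕ}
  {r : ℝ}

/-- An `ℕ`-valued variable with geometric tails has mean at most `r / (1 - r)`. -/
theorem lintegral_le_of_geometric_tail (hX : Measurable X) (hr0 : 0 < r) (hr1 : r < 1)
    (htail : ∀ n, μ {u | n + 1 ≤ X u} ≤ ENNReal.ofReal (r ^ (n + 1))) :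
    ∫⁻ u, (X u : ENNReal) ∂μ ≤ ENNReal.ofReal (r / (1 - r)) := by
  have h := lintegral_sum_range μ hX fun _ => 1
  simp only [Finset.sum_const, Finset.card_range, nsmul_eq_mul, mul_one, one_mul] at h
  rw [h]
  have hs : HasSum (fun n : ℕ => r ^ (n + 1)) (r / (1 - r)) := by
    simpa [pow_succ', div_eq_mul_inv] using (hasSum_geometric_of_lt_one hr0.le hr1).mul_left r
  rw [← hs.tsum_eq, ENNReal.ofReal_tsum_of_nonneg (fun n => by positivity) hs.summable]
  exact ENNReal.tsum_le_tsum htail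

theorem integrable_of_geometric_tail (hX : Measurable X) (hr0 : 0 < r) (hr1 : r < 1)
    (htail : ∀ n, μ {u | n + 1 ≤ X u} ≤ ENNReal.ofReal (r ^ (n + 1))) :
    Integrable (fun u => (X u : ℝ)) μ := by
  refine ⟨(measurable_from_top.comp hX).aestronglyMeasurable, ?_⟩
  rw [hasFiniteIntegral_iff_norm]
  simp only [Real.norm_natCast, ENNReal.ofReal_natCast]
  exact (lintegral_le_of_geometric_tail hX hr0 hr1 htail).trans_lt ENNReal.ofReal_lt_top

theorem integral_le_of_geometric_tail (hX : Measurable X) (hr0 : 0 < r) (hr1 : r < 1)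
    (htail : ∀ n, μ {u | n + 1 ≤ X u} ≤ ENNReal.ofReal (r ^ (n + 1))) :
    ∫ u, (X u : ℝ) ∂μ ≤ r / (1 - r) := by
  have hXm : Measurable fun u => (X u : ℝ) := measurable_from_top.comp hX
  rw [integral_eq_lintegral_of_nonneg_ae (ae_of_all _ fun u => by positivity)
    hXm.aestronglyMeasurable]
  refine ENNReal.toReal_le_of_le_ofReal (div_nonneg hr0.le (by linarith)) ?_
  simpa using lintegral_le_of_geometric_tail hX hr0 hr1 htail

/-- If `P(X ≥ n) ≤ s ^ (2 n)` then `s ^ (- X)` has expectation at most `2`. -/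
theorem lintegral_exp_le_of_geometric_tail [IsProbabilityMeasure μ] {s : ℝ} (hX : Measurable X) (hs0 : 0 < s) (hs1 : s < 1)
    (htail : ∀ n, μ {u | n + 1 ≤ X u} ≤ ENNReal.ofReal ((s ^ 2) ^ (n + 1))) :
    ∫⁻ u, ENNReal.ofReal ((s⁻¹) ^ X u) ∂μ ≤ 2 := by
  have hs : 1 < s⁻¹ := (one_lt_inv₀ hs0).2 hs1
  have hpt : ∀ u, ENNReal.ofReal ((s⁻¹) ^ X u)
      = 1 + ∑ n ∈ Finset.range (X u), ENNReal.ofReal ((s⁻¹ - 1) * s⁻¹ ^ n) := by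
    intro u
    have hpos : 0 ≤ s⁻¹ - 1 := by linarith
    rw [← ENNReal.ofReal_sum_of_nonneg fun n _ => by positivity, ← ENNReal.ofReal_one,
      ← ENNReal.ofReal_add zero_le_one (Finset.sum_nonneg fun n _ => by positivity),
      ← Finset.mul_sum, mul_comm, geom_sum_mul]
    congr 1; ring
  simp_rw [hpt]
  rw [lintegral_add_left measurable_const, lintegral_sum_range μ hX, lintegral_const, measure_univ,
    mul_one, ← one_add_one_eq_two]
  gcongr
  have hterm : ∀ n, ENNReal.ofReal ((s⁻¹ - 1) * s⁻¹ ^ n) * μ {u | n + 1 ≤ X u}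
      ≤ ENNReal.ofReal ((s - s ^ 2) * s ^ n) := by
    intro n
    refine (mul_le_mul_right (htail n) _).trans ?_
    rw [← ENNReal.ofReal_mul (mul_nonneg (by linarith) (by positivity))]
    refine ENNReal.ofReal_le_ofReal (le_of_eq ?_)
    have : s⁻¹ ^ n * s ^ n = 1 := by rw [← mul_pow, inv_mul_cancel₀ hs0.ne', one_pow]
    calc (s⁻¹ - 1) * s⁻¹ ^ n * (s ^ 2) ^ (n + 1)
        = (s⁻¹ * s - s) * s * (s⁻¹ ^ n * s ^ n) * s ^ n := by ring
      _ = _ := by rw [this, inv_mul_cancel₀ hs0.ne']; ring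
  have hsum : HasSum (fun n : ℕ => (s - s ^ 2) * s ^ n) ((s - s ^ 2) * (1 - s)⁻¹) :=
    (hasSum_geometric_of_lt_one hs0.le hs1).mul_left _
  have hnn : 0 ≤ s - s ^ 2 := by nlinarith
  refine (ENNReal.tsum_le_tsum hterm).trans ?_
  rw [← ENNReal.ofReal_tsum_of_nonneg (fun n => by positivity) hsum.summable, hsum.tsum_eq]
  refine ENNReal.ofReal_le_one.2 ?_
  have : (s - s ^ 2) * (1 - s)⁻¹ = s := by
    have : 1 - s ≠ 0 := by linarith
    field_simp
  linarith

theorem exp_le_one_add_add_sq_mul_exp_abs (y : ℝ) :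
    Real.exp y ≤ 1 + y + y ^ 2 * Real.exp |y| := by
  have h := Complex.norm_exp_sub_sum_le_norm_mul_exp (y : ℂ) 2
  have h2 : (Complex.exp y - ∑ m ∈ Finset.range 2, (y : ℂ) ^ m / m.factorial)
      = ((Real.exp y - (1 + y) : ℝ) : ℂ) := by
    simp [Finset.sum_range_succ]
  rw [h2, Complex.norm_real, Complex.norm_real, Real.norm_eq_abs, Real.norm_eq_abs, sq_abs] at h
  linarith [le_abs_self (Real.exp y - (1 + y))]

theorem sq_mul_exp_le {z c : ℝ} (hz : 0 ≤ z) (hc : c ≤ 1 / 8) :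
    z ^ 2 * Real.exp (c * z) ≤ 18 * Real.exp (z / 2) := by
  have h1 : z ^ 2 ≤ 18 * Real.exp (z / 3) := by
    have := Real.quadratic_le_exp_of_nonneg (x := z / 3) (by positivity)
    nlinarith
  calc z ^ 2 * Real.exp (c * z) ≤ 18 * Real.exp (z / 3) * Real.exp (z / 8) := by
        gcongr; nlinarith
    _ = 18 * Real.exp (z / 3 + z / 8) := by rw [mul_assoc, ← Real.exp_add]
    _ ≤ _ := by gcongr; linarith

/-- An `ℕ`-valued variable with `P(X ≥ n) ≤ r ^ n` is sub-exponential with parameter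
`8 e / log (1 / r)`. -/
theorem lintegral_exp_centered_le [IsProbabilityMeasure μ] (hX : Measurable X) (hr0 : 0 < r) (hr1 : r < 1)
    (htail : ∀ n, μ {u | n + 1 ≤ X u} ≤ ENNReal.ofReal (r ^ (n + 1)))
    {τ c : ℝ} (hτ : τ = 8 * Real.exp 1 / Real.log (1 / r)) (hc : |c| ≤ 1 / τ) :
    ∫⁻ u, ENNReal.ofReal (Real.exp (c * (X u - ∫ v, (X v : ℝ) ∂μ))) ∂μ
      ≤ ENNReal.ofReal (Real.exp (c ^ 2 * τ ^ 2 / 2)) := by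
  set m := ∫ v, (X v : ℝ) ∂μ with hm
  set l := Real.log (1 / r) with hl
  have hl0 : 0 < l := Real.log_pos ((one_lt_div hr0).2 hr1)
  have hint := integrable_of_geometric_tail hX hr0 hr1 htail
  have hm0 : 0 ≤ m := integral_nonneg fun u => by positivity
  have hm1 : l * m ≤ 1 := by
    have h1 := integral_le_of_geometric_tail hX hr0 hr1 htail
    have h2 : l ≤ (1 - r) / r := by
      have := Real.log_le_sub_one_of_pos (x := 1 / r) (by positivity)
      have h3 : (1 - r) / r = 1 / r - 1 := by field_simp
      rwa [h3]
    have h4 : (1 - r) / r * (r / (1 - r)) = 1 := by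
      have : 1 - r ≠ 0 := by linarith
      field_simp
    calc l * m ≤ (1 - r) / r * (r / (1 - r)) := by
          refine mul_le_mul h2 h1 hm0 ?_
          exact hl0.le.trans h2
      _ = 1 := h4
  have hexp : (2.7 : ℝ) ≤ Real.exp 1 := by linarith [Real.exp_one_gt_d9]
  set s := Real.exp (-(l / 2)) with hs
  have hs0 : 0 < s := Real.exp_pos _
  have hs1 : s < 1 := Real.exp_lt_one_iff.2 (by linarith)
  have hs2 : s ^ 2 = r := by
    rw [hs, ← Real.exp_nat_mul]
    rw [show ((2 : ℕ) : ℝ) * -(l / 2) = Real.log r by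
      rw [hl, one_div, Real.log_inv]; push_cast; ring]
    exact Real.exp_log hr0
  have hmgf := lintegral_exp_le_of_geometric_tail (μ := μ) hX hs0 hs1 (by rwa [hs2])
  have hsX : ∀ u, (s⁻¹) ^ X u = Real.exp (l * X u / 2) := by
    intro u
    rw [hs, ← Real.exp_neg, ← Real.exp_nat_mul]
    congr 1; ring
  simp_rw [hsX] at hmgf
  have hXm : Measurable fun u => (X u : ℝ) := measurable_from_top.comp hX
  have hEint : Integrable (fun u => Real.exp (l * X u / 2)) μ := by
    refine ⟨(by fun_prop : Measurable _).aestronglyMeasurable, ?_⟩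
    rw [hasFiniteIntegral_iff_norm]
    simp only [Real.norm_eq_abs, Real.abs_exp]
    exact hmgf.trans_lt (by simp)
  have hE2 : ∫ u, Real.exp (l * X u / 2) ∂μ ≤ 2 := by
    rw [integral_eq_lintegral_of_nonneg_ae (ae_of_all _ fun u => (Real.exp_pos _).le)
      hEint.aestronglyMeasurable]
    exact ENNReal.toReal_le_of_le_ofReal (by norm_num) (by simpa using hmgf)
  have hcl : |c| / l ≤ 1 / 8 := by
    rw [div_le_iff₀ hl0]
    refine hc.trans ?_
    rw [hτ, one_div_div, div_le_iff₀ (by positivity)]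
    nlinarith
  have hpt : ∀ u, Real.exp (c * (X u - m))
      ≤ 1 + c * (X u - m)
        + c ^ 2 * (18 / l ^ 2 * Real.exp (1 / 2)) * Real.exp (l * X u / 2) := by
    intro u
    refine (exp_le_one_add_add_sq_mul_exp_abs _).trans ?_
    have hX0 : (0 : ℝ) ≤ X u := by positivity
    have h1 := sq_mul_exp_le (z := l * |X u - m|) (c := |c| / l) (by positivity) hcl
    have h2 : Real.exp (l * |X u - m| / 2) ≤ Real.exp (1 / 2) * Real.exp (l * X u / 2) := by
      rw [← Real.exp_add]
      refine Real.exp_le_exp.2 ?_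
      have : |X u - m| ≤ X u + m := by rw [abs_le]; constructor <;> linarith
      nlinarith
    have h3 : |c| / l * (l * |X u - m|) = |c * (X u - m)| := by
      rw [abs_mul]; field_simp
    rw [h3, mul_pow, sq_abs] at h1
    have h4 : (X u - m) ^ 2 * Real.exp |c * (X u - m)|
        ≤ 18 / l ^ 2 * Real.exp (1 / 2) * Real.exp (l * X u / 2) := by
      have : (X u - m) ^ 2 * Real.exp |c * (X u - m)|
          = (l ^ 2 * (X u - m) ^ 2 * Real.exp |c * (X u - m)|) / l ^ 2 := by
        field_simp
      rw [this, div_le_iff₀ (by positivity)]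
      calc _ ≤ 18 * (Real.exp (1 / 2) * Real.exp (l * X u / 2)) := by linarith
        _ = _ := by field_simp
    have h5 := mul_le_mul_of_nonneg_left h4 (sq_nonneg c)
    rw [mul_pow]
    linarith
  have hcen : Integrable (fun u => c * ((X u : ℝ) - m)) μ :=
    (hint.sub (integrable_const _)).const_mul _
  have hlin : Integrable (fun u => 1 + c * ((X u : ℝ) - m)) μ := (integrable_const _).add hcen
  have hrhs : Integrable (fun u => 1 + c * ((X u : ℝ) - m)
      + c ^ 2 * (18 / l ^ 2 * Real.exp (1 / 2)) * Real.exp (l * X u / 2)) μ :=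
    hlin.add (hEint.const_mul _)
  have hlhs : Integrable (fun u => Real.exp (c * ((X u : ℝ) - m))) μ := by
    refine hrhs.mono' (by fun_prop : Measurable _).aestronglyMeasurable
      (ae_of_all _ fun u => ?_)
    rw [Real.norm_eq_abs, Real.abs_exp]
    exact hpt u
  rw [← ofReal_integral_eq_lintegral_ofReal hlhs (ae_of_all _ fun u => (Real.exp_pos _).le)]
  refine ENNReal.ofReal_le_ofReal ((integral_mono hlhs hrhs hpt).trans ?_)
  rw [integral_add hlin (hEint.const_mul _), integral_const_mul,
    integral_add (integrable_const _) hcen, integral_const_mul, integral_sub hint (integrable_const _), ← hm]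
  simp only [integral_const, probReal_univ, one_smul, sub_self, mul_zero, add_zero]
  have he : Real.exp (1 / 2) ≤ Real.exp 1 := Real.exp_le_exp.2 (by norm_num)
  have hτ2 : c ^ 2 * τ ^ 2 / 2 = c ^ 2 / l ^ 2 * (32 * Real.exp 1 ^ 2) := by
    rw [hτ]; field_simp; ring
  refine le_trans ?_ (Real.add_one_le_exp _)
  rw [hτ2]
  calc 1 + c ^ 2 * (18 / l ^ 2 * Real.exp (1 / 2)) * ∫ u, Real.exp (l * X u / 2) ∂μ
      ≤ 1 + c ^ 2 * (18 / l ^ 2 * Real.exp (1 / 2)) * 2 := by gcongr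
    _ = 1 + c ^ 2 / l ^ 2 * (36 * Real.exp (1 / 2)) := by ring
    _ ≤ 1 + c ^ 2 / l ^ 2 * (32 * Real.exp 1 ^ 2) := by
      have : 36 * Real.exp (1 / 2) ≤ 32 * Real.exp 1 ^ 2 := by nlinarith
      gcongr _ + _ * ?_
    _ = _ := by ring

end SubExponential
/-- The expected number of iterations of a user who stays in iteration `j` with probability
`f j`. -/
noncomputable def stayValue (f : ℕ → ℝ) : ℝ := ∑' n, ∏ j ∈ Finset.range n, f j

section StayValue

variable {f : ℕ → ℝ} {r : ℝ}

theorem prod_range_le_pow (h0 : ∀ j, 0 ≤ f j) (hr : ∀ j, f j ≤ r) (n : ℕ) :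
    ∏ j ∈ Finset.range n, f j ≤ r ^ n := by
  calc _ ≤ ∏ j ∈ Finset.range n, r := Finset.prod_le_prod (fun _ _ => h0 _) fun _ _ => hr _
    _ = _ := by simp

theorem summable_stayValue (h0 : ∀ j, 0 ≤ f j) (hr : ∀ j, f j ≤ r) (hr1 : r < 1) :
    Summable fun n => ∏ j ∈ Finset.range n, f j :=
  .of_nonneg_of_le (fun _ => Finset.prod_nonneg fun _ _ => h0 _) (prod_range_le_pow h0 hr)
    (summable_geometric_of_lt_one ((h0 0).trans (hr 0)) hr1)

theorem stayValue_nonneg (h0 : ∀ j, 0 ≤ f j) : 0 ≤ stayValue f :=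
  tsum_nonneg fun _ => Finset.prod_nonneg fun _ _ => h0 _

theorem stayValue_le (h0 : ∀ j, 0 ≤ f j) (hr : ∀ j, f j ≤ r) (hr1 : r < 1) :
    stayValue f ≤ 1 / (1 - r) := by
  have hr0 := (h0 0).trans (hr 0)
  rw [one_div, ← tsum_geometric_of_lt_one hr0 hr1]
  exact (summable_stayValue h0 hr hr1).tsum_le_tsum (prod_range_le_pow h0 hr)
    (summable_geometric_of_lt_one hr0 hr1)

theorem stayValue_eq_one_add (h0 : ∀ j, 0 ≤ f j) (hr : ∀ j, f j ≤ r) (hr1 : r < 1) :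
    stayValue f = 1 + ∑' n, ∏ j ∈ Finset.range (n + 1), f j := by
  rw [stayValue, (summable_stayValue h0 hr hr1).tsum_eq_zero_add]
  simp

theorem stayValue_eq_one_add_mul (h0 : ∀ j, 0 ≤ f j) (hr : ∀ j, f j ≤ r) (hr1 : r < 1) :
    stayValue f = 1 + f 0 * stayValue fun j => f (j + 1) := by
  rw [stayValue_eq_one_add h0 hr hr1, stayValue, ← tsum_mul_left]
  simp_rw [Finset.prod_range_succ', mul_comm]

theorem stayValue_const {c : ℝ} (h0 : 0 ≤ c) (h1 : c < 1) : stayValue (fun _ => c) = 1 / (1 - c) := by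
  simp [stayValue, tsum_geometric_of_lt_one h0 h1]

end StayValue

/-- The sequence of categories recommended by the `(a, h)`-threshold policy. -/
def thresholdPath (a : Category) (h : ℕ) : ℕ → Category := fun j => if j < h then a else 1 - a

theorem clickPath_thresholdPolicy (a : Category) (h : ℕ) :
    clickPath (thresholdPolicy a h) = thresholdPath a h := by
  ext1 j
  simp [clickPath, thresholdPolicy, thresholdPath, clickHistory_length]

/-- The expected number of iterations when the types have weights `w`, clicks have probabilities
`p`, and `σ` is the recommended sequence of categories. -/
noncomputable def pathValue (p : Category → UserType → ℝ) (w : UserType → ℝ) (σ : ℕ → Category) :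
    ℝ :=
  ∑ x, w x * stayValue fun j => p (σ j) x

/-- One of three modifications of the recommendation sequence `b a^h b^∞` is no worse, in the case
that type `0` prefers `a` and type `1` prefers `b`. -/
theorem threshold_comparison {a₀ a₁ b₀ b₁ w₀ w₁ : ℝ} {h : ℕ} (ha₀ : a₀ < 1) (ha₁ : 0 < a₁)
    (hb₀ : 0 < b₀) (hb₁ : b₁ < 1) (hD₀ : b₀ < a₀) (hD₁ : a₁ < b₁)
    (hw₀ : 0 ≤ w₀) (hw₁ : 0 ≤ w₁) {s₀ s₁ : ℝ} (hs₀ : s₀ * (1 - a₀) = 1 - a₀ ^ h)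
    (hs₁ : s₁ * (1 - a₁) = 1 - a₁ ^ h) :
    0 ≤ w₀ * (s₀ * (a₀ - b₀)) + w₁ * (s₁ * (a₁ - b₁)) ∨
    0 ≤ w₀ * (b₀ * s₀ * (b₀ - a₀) / (1 - b₀)) + w₁ * (b₁ * s₁ * (b₁ - a₁) / (1 - b₁)) ∨
    0 ≤ w₀ * (b₀ * a₀ ^ h * (a₀ - b₀) / ((1 - a₀) * (1 - b₀)))
      + w₁ * (b₁ * a₁ ^ h * (a₁ - b₁) / ((1 - a₁) * (1 - b₁))) := by
  have ha₀0 : 0 < a₀ := hb₀.trans hD₀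
  have ha₁1 : a₁ < 1 := hD₁.trans hb₁
  have hb₀1 : b₀ < 1 := hD₀.trans ha₀
  have hb₁0 : 0 < b₁ := ha₁.trans hD₁
  have hs₀0 : 0 ≤ s₀ := by
    have := pow_le_one₀ (n := h) ha₀0.le ha₀.le
    by_contra hc
    nlinarith
  have hs₁0 : 0 ≤ s₁ := by
    have := pow_le_one₀ (n := h) ha₁.le ha₁1.le
    by_contra hc
    nlinarith
  set y₀ := w₀ * (s₀ * (a₀ - b₀)) with hy₀
  set y₁ := w₁ * (s₁ * (b₁ - a₁)) with hy₁
  have hy₀0 : 0 ≤ y₀ := by have : 0 ≤ a₀ - b₀ := by linarith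
                           positivity
  have hy₁0 : 0 ≤ y₁ := by have : 0 ≤ b₁ - a₁ := by linarith
                           positivity
  have e1 : w₀ * (s₀ * (a₀ - b₀)) + w₁ * (s₁ * (a₁ - b₁)) = y₀ - y₁ := by rw [hy₀, hy₁]; ring
  have e2 : w₀ * (b₀ * s₀ * (b₀ - a₀) / (1 - b₀)) + w₁ * (b₁ * s₁ * (b₁ - a₁) / (1 - b₁))
      = y₁ * (b₁ / (1 - b₁)) - y₀ * (b₀ / (1 - b₀)) := by rw [hy₀, hy₁]; ring
  have hβ₀ : 0 < b₀ / (1 - b₀) := div_pos hb₀ (by linarith)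
  have hβ₁ : 0 < b₁ / (1 - b₁) := div_pos hb₁0 (by linarith)
  rw [e1, e2]
  by_cases h1 : y₁ ≤ y₀
  · left; linarith
  by_cases h2 : y₀ * (b₀ / (1 - b₀)) ≤ y₁ * (b₁ / (1 - b₁))
  · right; left; linarith
  right; right
  push Not at h1 h2
  have hb : b₁ < b₀ := by
    by_contra hc
    push Not at hc
    have : b₀ / (1 - b₀) ≤ b₁ / (1 - b₁) := by
      rw [div_le_div_iff₀ (by linarith) (by linarith)]; nlinarith
    have := mul_le_mul h1.le this hβ₀.le hy₁0
    linarith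
  have hpow : a₁ ^ h ≤ a₀ ^ h := pow_le_pow_left₀ ha₁.le (by linarith) h
  have hpow1 : 0 < a₁ ^ h := by positivity
  have key : a₁ ^ h / (1 - a₁) * s₀ ≤ a₀ ^ h / (1 - a₀) * s₁ := by
    have n0 : 1 - a₀ ≠ 0 := by linarith
    have n1 : 1 - a₁ ≠ 0 := by linarith
    have q0 : s₀ = (1 - a₀ ^ h) / (1 - a₀) := by rw [← hs₀]; field_simp
    have q1 : s₁ = (1 - a₁ ^ h) / (1 - a₁) := by rw [← hs₁]; field_simp
    rw [q0, q1, div_mul_div_comm, div_mul_div_comm, mul_comm (1 - a₁)]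
    refine div_le_div_of_nonneg_right (by nlinarith) (mul_nonneg ?_ ?_) <;> linarith
  have hs₁p : 0 < s₁ := by
    rcases hs₁0.lt_or_eq with hp | hz
    · exact hp
    · rw [hy₁, ← hz] at h1; simp at h1; linarith
  have hs₀p : 0 < s₀ := by
    rcases hs₀0.lt_or_eq with hp | hz
    · exact hp
    · rw [hy₀, ← hz] at h2; simp at h2
      have := mul_nonneg hy₁0 hβ₁.le
      linarith
  have hmul : y₁ * (b₁ / (1 - b₁)) * (a₁ ^ h / (1 - a₁) * s₀)
      ≤ y₀ * (b₀ / (1 - b₀)) * (a₀ ^ h / (1 - a₀) * s₁) := by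
    refine mul_le_mul h2.le key ?_ (mul_nonneg hy₀0 hβ₀.le)
    exact mul_nonneg (div_nonneg hpow1.le (by linarith)) hs₀0
  have e3 : (w₀ * (b₀ * a₀ ^ h * (a₀ - b₀) / ((1 - a₀) * (1 - b₀)))
      + w₁ * (b₁ * a₁ ^ h * (a₁ - b₁) / ((1 - a₁) * (1 - b₁)))) * (s₀ * s₁)
      = y₀ * (b₀ / (1 - b₀)) * (a₀ ^ h / (1 - a₀) * s₁)
        - y₁ * (b₁ / (1 - b₁)) * (a₁ ^ h / (1 - a₁) * s₀) := by
    have n0 : 1 - a₀ ≠ 0 := by linarith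
    have n1 : 1 - a₁ ≠ 0 := by linarith
    have n2 : 1 - b₀ ≠ 0 := by linarith
    have n3 : 1 - b₁ ≠ 0 := by linarith
    rw [hy₀, hy₁]
    field_simp
    ring
  have : 0 < s₀ * s₁ := by positivity
  by_contra hc
  push Not at hc
  nlinarith

section Threshold

variable {p : Category → UserType → ℝ} {r : ℝ}

theorem stayValue_thresholdPath (hp0 : ∀ a x, 0 < p a x) (hpr : ∀ a x, p a x ≤ r) (hr1 : r < 1)
    (a : Category) (h : ℕ) (x : UserType) :
    stayValue (fun j => p (thresholdPath a h j) x)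
      = ∑ k ∈ Finset.range h, p a x ^ k + p a x ^ h / (1 - p (1 - a) x) := by
  induction h with
  | zero =>
    simp [thresholdPath, stayValue_const (hp0 _ _).le ((hpr _ _).trans_lt hr1)]
  | succ h ih =>
    have hshift : (fun j => p (thresholdPath a (h + 1) (j + 1)) x)
        = fun j => p (thresholdPath a h j) x := by
      ext j; simp [thresholdPath]
    rw [stayValue_eq_one_add_mul (fun j => (hp0 _ _).le) (fun j => hpr _ _) hr1, hshift, ih,
      Finset.sum_range_succ']
    simp only [thresholdPath, Nat.zero_lt_succ, if_true, pow_succ, ← Finset.sum_mul]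
    ring

/-- Recommending any category first and following a threshold policy afterwards is no better than
some threshold policy. -/
theorem exists_threshold_ge_cons (hp0 : ∀ a x, 0 < p a x) (hpr : ∀ a x, p a x ≤ r) (hr1 : r < 1)
    {w : UserType → ℝ} (hw : ∀ x, 0 ≤ w x) (b a : Category) (h : ℕ) :
    ∃ a' h', ∑ x, w x + pathValue p (fun x => w x * p b x) (thresholdPath a h)
      ≤ pathValue p w (thresholdPath a' h') := by
  have hp1 : ∀ a x, p a x < 1 := fun a x => (hpr a x).trans_lt hr1
  have hS := stayValue_thresholdPath hp0 hpr hr1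
  have hcons : ∑ x, w x + pathValue p (fun x => w x * p b x) (thresholdPath a h)
      = ∑ x, w x * (1 + p b x * stayValue fun j => p (thresholdPath a h j) x) := by
    simp only [pathValue, ← Finset.sum_add_distrib]
    exact Finset.sum_congr rfl fun x _ => by ring
  rw [hcons]
  by_cases hba : b = a
  · refine ⟨a, h + 1, le_of_eq ?_⟩
    refine Finset.sum_congr rfl fun x _ => ?_
    rw [hS, hS, hba, Finset.sum_range_succ']
    simp only [pow_succ, ← Finset.sum_mul]
    ring
  have hb : b = 1 - a := (by decide : ∀ b a : Category, b ≠ a → b = 1 - a) b a hba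
  have hb' : 1 - b = a := (by decide : ∀ b a : Category, b = 1 - a → 1 - b = a) b a hb
  set s : UserType → ℝ := fun x => ∑ k ∈ Finset.range h, p a x ^ k with hs
  have hsmul : ∀ x, s x * (1 - p a x) = 1 - p a x ^ h := fun x => by
    have := geom_sum_mul (p a x) h
    simp only [hs]; linarith
  have hs0 : ∀ x, 0 ≤ s x := fun x => Finset.sum_nonneg fun k _ => pow_nonneg (hp0 a x).le k
  have hA : ∀ x, stayValue (fun j => p (thresholdPath a h j) x) = s x + p a x ^ h / (1 - p b x) := by
    intro x; rw [hS, ← hb]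
  have hB : ∀ x, w x * (stayValue fun j => p (thresholdPath a h j) x)
      - w x * (1 + p b x * stayValue fun j => p (thresholdPath a h j) x)
      = w x * (s x * (p a x - p b x)) := by
    intro x
    have n : 1 - p b x ≠ 0 := by linarith [hp1 b x]
    have e : p a x ^ h = 1 - s x * (1 - p a x) := by linarith [hsmul x]
    rw [hA, e]; field_simp; ring
  have hC : ∀ x, w x * (stayValue fun j => p (thresholdPath a 0 j) x)
      - w x * (1 + p b x * stayValue fun j => p (thresholdPath a h j) x)
      = w x * (p b x * s x * (p b x - p a x) / (1 - p b x)) := by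
    intro x
    have n : 1 - p b x ≠ 0 := by linarith [hp1 b x]
    have e : p a x ^ h = 1 - s x * (1 - p a x) := by linarith [hsmul x]
    rw [hA, hS, ← hb, e]
    simp only [Finset.range_zero, Finset.sum_empty, pow_zero, zero_add]
    field_simp; ring
  have hD : ∀ x, w x * (stayValue fun j => p (thresholdPath b 1 j) x)
      - w x * (1 + p b x * stayValue fun j => p (thresholdPath a h j) x)
      = w x * (p b x * p a x ^ h * (p a x - p b x) / ((1 - p a x) * (1 - p b x))) := by
    intro x
    have n : 1 - p b x ≠ 0 := by linarith [hp1 b x]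
    have n' : 1 - p a x ≠ 0 := by linarith [hp1 a x]
    have e : s x = (1 - p a x ^ h) / (1 - p a x) := by rw [← hsmul x]; field_simp
    rw [hA, hS, hb', e]
    simp only [Finset.sum_range_one, pow_zero, pow_one]
    field_simp; ring
  have hcase : 0 ≤ ∑ x, w x * (s x * (p a x - p b x)) ∨
      0 ≤ ∑ x, w x * (p b x * s x * (p b x - p a x) / (1 - p b x)) ∨
      0 ≤ ∑ x, w x * (p b x * p a x ^ h * (p a x - p b x) / ((1 - p a x) * (1 - p b x))) := by
    by_cases h1 : ∀ x, p b x ≤ p a x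
    · left
      exact Finset.sum_nonneg fun x _ => mul_nonneg (hw x) (mul_nonneg (hs0 x) (by linarith [h1 x]))
    by_cases h2 : ∀ x, p a x ≤ p b x
    · right; left
      refine Finset.sum_nonneg fun x _ => mul_nonneg (hw x) (div_nonneg (mul_nonneg
        (mul_nonneg (hp0 b x).le (hs0 x)) (by linarith [h2 x])) (by linarith [hp1 b x]))
    push Not at h1 h2
    obtain ⟨y, hy⟩ := h1
    obtain ⟨x, hx⟩ := h2
    have hsum : ∀ f : UserType → ℝ, ∑ z, f z = f x + f y := by
      intro f
      have hxy : x ≠ y := by rintro rfl; linarith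
      rw [Fin.sum_univ_two]
      fin_cases x <;> fin_cases y <;> simp_all [add_comm]
    simp only [hsum]
    exact threshold_comparison (hp1 a x) (hp0 a y) (hp0 b x) (hp1 b y) hx hy (hw x) (hw y)
      (hsmul x) (hsmul y)
  rcases hcase with h1 | h1 | h1
  · refine ⟨a, h, ?_⟩
    rw [← sub_nonneg, pathValue, ← Finset.sum_sub_distrib]
    simpa only [hB] using h1
  · refine ⟨a, 0, ?_⟩
    rw [← sub_nonneg, pathValue, ← Finset.sum_sub_distrib]
    simpa only [hC] using h1
  · refine ⟨b, 1, ?_⟩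
    rw [← sub_nonneg, pathValue, ← Finset.sum_sub_distrib]
    simpa only [hD] using h1

/-- Threshold policies approximate the value of every recommendation sequence. -/
theorem exists_threshold_ge_sub (hp0 : ∀ a x, 0 < p a x) (hpr : ∀ a x, p a x ≤ r) (hr1 : r < 1)
    (n : ℕ) : ∀ (σ : ℕ → Category) {w : UserType → ℝ}, (∀ x, 0 ≤ w x) →
      ∃ a h, pathValue p w σ ≤ pathValue p w (thresholdPath a h) + r ^ n / (1 - r) * ∑ x, w x := by
  have hr0 : 0 < r := (hp0 0 0).trans_le (hpr 0 0)
  induction n with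
  | zero =>
    intro σ w hw
    refine ⟨0, 0, ?_⟩
    have h1 : pathValue p w σ ≤ r ^ 0 / (1 - r) * ∑ x, w x := by
      rw [pathValue, pow_zero, Finset.mul_sum]
      refine Finset.sum_le_sum fun x _ => ?_
      rw [mul_comm]
      exact mul_le_mul_of_nonneg_right
        (stayValue_le (fun j => (hp0 _ _).le) (fun j => hpr _ _) hr1) (hw x)
    have h2 : 0 ≤ pathValue p w (thresholdPath 0 0) :=
      Finset.sum_nonneg fun x _ => mul_nonneg (hw x) (stayValue_nonneg fun j => (hp0 _ _).le)
    linarith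
  | succ n ih =>
    intro σ w hw
    obtain ⟨a, h, hah⟩ := ih (fun j => σ (j + 1)) (w := fun x => w x * p (σ 0) x)
      fun x => mul_nonneg (hw x) (hp0 _ _).le
    obtain ⟨a', h', hah'⟩ := exists_threshold_ge_cons hp0 hpr hr1 hw (σ 0) a h
    refine ⟨a', h', ?_⟩
    have hstep : pathValue p w σ
        = ∑ x, w x + pathValue p (fun x => w x * p (σ 0) x) fun j => σ (j + 1) := by
      simp only [pathValue, ← Finset.sum_add_distrib]
      refine Finset.sum_congr rfl fun x _ => ?_
      rw [stayValue_eq_one_add_mul (fun j => (hp0 _ _).le) (fun j => hpr _ _) hr1]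
      ring
    have hwt : r ^ n / (1 - r) * ∑ x, w x * p (σ 0) x ≤ r ^ (n + 1) / (1 - r) * ∑ x, w x := by
      have : ∑ x, w x * p (σ 0) x ≤ (∑ x, w x) * r := by
        rw [Finset.sum_mul]
        exact Finset.sum_le_sum fun x _ => mul_le_mul_of_nonneg_left (hpr _ _) (hw x)
      have hc : 0 ≤ r ^ n / (1 - r) := div_nonneg (by positivity) (by linarith)
      calc _ ≤ r ^ n / (1 - r) * ((∑ x, w x) * r) := mul_le_mul_of_nonneg_left this hc
        _ = _ := by ring
    linarith

theorem abs_pathValue_threshold_sub_le (hp0 : ∀ a x, 0 < p a x) (hpr : ∀ a x, p a x ≤ r)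
    (hr1 : r < 1) {w : UserType → ℝ} (hw : ∀ x, 0 ≤ w x) (a : Category) (h : ℕ) :
    |pathValue p w (thresholdPath a h) - pathValue p w (thresholdPath (1 - a) 0)|
      ≤ r ^ h / (1 - r) * ∑ x, w x := by
  have hr0 : 0 < r := (hp0 0 0).trans_le (hpr 0 0)
  have hp1 : ∀ a x, p a x < 1 := fun a x => (hpr a x).trans_lt hr1
  rw [pathValue, pathValue, ← Finset.sum_sub_distrib, Finset.mul_sum]
  refine (Finset.abs_sum_le_sum_abs _ _).trans (Finset.sum_le_sum fun x _ => ?_)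
  rw [← mul_sub, abs_mul, abs_of_nonneg (hw x), mul_comm]
  refine mul_le_mul_of_nonneg_right ?_ (hw x)
  rw [stayValue_thresholdPath hp0 hpr hr1, stayValue_thresholdPath hp0 hpr hr1]
  have ha : (1 : Category) - (1 - a) = a := by revert a; decide
  have n : 1 - p a x ≠ 0 := by linarith [hp1 a x]
  have e : ∑ k ∈ Finset.range h, p a x ^ k = (1 - p a x ^ h) / (1 - p a x) := by
    rw [eq_div_iff n]; linarith [geom_sum_mul (p a x) h]
  have hpow : p a x ^ h ≤ r ^ h := pow_le_pow_left₀ (hp0 a x).le (hpr a x) h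
  have hpow0 : 0 < p a x ^ h := pow_pos (hp0 a x) h
  have bound : ∀ c, p a x ^ h / (1 - p c x) ≤ r ^ h / (1 - r) := fun c => by
    have := hpr c x
    exact div_le_div₀ (by positivity) hpow (by linarith) (by linarith)
  have pos : ∀ c, 0 ≤ p a x ^ h / (1 - p c x) := fun c =>
    div_nonneg hpow0.le (by linarith [hp1 c x])
  rw [ha, e]
  have : (1 - p a x ^ h) / (1 - p a x) + p a x ^ h / (1 - p (1 - a) x)
      - (∑ k ∈ Finset.range 0, p (1 - a) x ^ k + p (1 - a) x ^ 0 / (1 - p a x))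
      = p a x ^ h / (1 - p (1 - a) x) - p a x ^ h / (1 - p a x) := by
    simp only [Finset.range_zero, Finset.sum_empty, pow_zero]; ring
  rw [this, abs_le]
  constructor <;> linarith [bound a, bound (1 - a), pos a, pos (1 - a)]

theorem exists_forall_le_of_tendsto {f : Category → ℕ → ℝ}
    (hf : ∀ a, Tendsto (f a) atTop (nhds (f (1 - a) 0))) : ∃ a h, ∀ a' h', f a' h' ≤ f a h := by
  obtain ⟨a₀, ha₀⟩ : ∃ a₀, ∀ a, f a 0 ≤ f a₀ 0 := Finite.exists_max _
  by_cases hall : ∀ a h, f a h ≤ f a₀ 0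
  · exact ⟨a₀, 0, hall⟩
  push Not at hall
  obtain ⟨a₁, h₁, hlt⟩ := hall
  have hev : ∀ᶠ h in atTop, ∀ a, f a h < f a₁ h₁ :=
    eventually_all.2 fun a => (hf a).eventually_lt_const ((ha₀ _).trans_lt hlt)
  obtain ⟨N, hN⟩ := eventually_atTop.1 hev
  obtain ⟨⟨a, h⟩, -, hmax⟩ := Finset.exists_max_image
    ((Finset.univ : Finset Category) ×ˢ Finset.range (max N h₁ + 1)) (fun i => f i.1 i.2)
    ⟨(0, 0), by simp⟩
  refine ⟨a, h, fun a' h' => ?_⟩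
  by_cases hh : h' < max N h₁ + 1
  · exact hmax (a', h') (by simpa using hh)
  · exact (hN h' (by omega) a').le.trans
      (hmax (a₁, h₁) (by simp))

/-- Some threshold sequence is optimal among all recommendation sequences. -/
theorem exists_threshold_optimal (hp0 : ∀ a x, 0 < p a x) (hpr : ∀ a x, p a x ≤ r) (hr1 : r < 1)
    {w : UserType → ℝ} (hw : ∀ x, 0 ≤ w x) :
    ∃ a h, ∀ σ, pathValue p w σ ≤ pathValue p w (thresholdPath a h) := by
  have hr0 : 0 < r := (hp0 0 0).trans_le (hpr 0 0)
  have hlim : Tendsto (fun n : ℕ => r ^ n / (1 - r) * ∑ x, w x) atTop (nhds 0) := by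
    simpa using ((tendsto_pow_atTop_nhds_zero_of_lt_one hr0.le hr1).div_const (1 - r)).mul_const
      (∑ x, w x)
  obtain ⟨a, h, hmax⟩ := exists_forall_le_of_tendsto
    (f := fun a h => pathValue p w (thresholdPath a h)) fun a =>
      tendsto_iff_norm_sub_tendsto_zero.2 <| squeeze_zero (fun _ => norm_nonneg _)
        (fun h => abs_pathValue_threshold_sub_le hp0 hpr hr1 hw a h) hlim
  refine ⟨a, h, fun σ => ?_⟩
  refine ge_of_tendsto' (x := atTop) (f := fun n : ℕ => pathValue p w (thresholdPath a h)
    + r ^ n / (1 - r) * ∑ x, w x) (by simpa using hlim.const_add _) fun n => ?_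
  obtain ⟨a', h', hn⟩ := exists_threshold_ge_sub hp0 hpr hr1 n σ hw
  exact hn.trans (by gcongr; exact hmax a' h')

/-- Restricting the threshold to `h ≤ H` costs at most a geometrically small amount. -/
theorem exists_threshold_le (hp0 : ∀ a x, 0 < p a x) (hpr : ∀ a x, p a x ≤ r) (hr1 : r < 1)
    {w : UserType → ℝ} (hw : ∀ x, 0 ≤ w x) (H : ℕ) (a : Category) (h : ℕ) :
    ∃ a', ∃ h' ≤ H, pathValue p w (thresholdPath a h)
      ≤ pathValue p w (thresholdPath a' h') + r ^ H / (1 - r) * ∑ x, w x := by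
  have hr0 : 0 < r := (hp0 0 0).trans_le (hpr 0 0)
  have hw' : 0 ≤ ∑ x, w x := Finset.sum_nonneg fun x _ => hw x
  by_cases hh : h ≤ H
  · refine ⟨a, h, hh, ?_⟩
    have : 0 ≤ r ^ H / (1 - r) := div_nonneg (by positivity) (by linarith)
    have := mul_nonneg this hw'
    linarith
  · refine ⟨1 - a, 0, Nat.zero_le _, ?_⟩
    have h1 := (abs_le.1 (abs_pathValue_threshold_sub_le hp0 hpr hr1 hw a h)).2
    have h2 : r ^ h / (1 - r) ≤ r ^ H / (1 - r) :=
      div_le_div_of_nonneg_right (pow_le_pow_of_le_one hr0.le hr1.le (by omega)) (by linarith)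
    have := mul_le_mul_of_nonneg_right h2 hw'
    linarith

end Threshold

theorem integrable_policyReturn (I : BanditInstance) {r : ℝ} (hr : ∀ a x, I.P a x ≤ r)
    (hr1 : r < 1) (π : Policy) :
    Integrable (fun u => (policyReturn π u.2 : ℝ)) (userLaw I) :=
  integrable_of_geometric_tail (X := fun u : UserType × ClickTable => policyReturn π u.2)
    (measurable_userReturn π)
    ((I.P_pos 0 0).trans_le (hr 0 0)) hr1 (userLaw_tail_le I hr π)

theorem expectedReturn_eq (I : BanditInstance) {r : ℝ} (hr : ∀ a x, I.P a x ≤ r) (hr1 : r < 1)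
    (π : Policy) : expectedReturn I π = pathValue I.P I.q (clickPath π) - 1 := by
  have hX : Measurable fun u : UserType × ClickTable => policyReturn π u.2 := measurable_userReturn π
  have hsv : ∀ x, stayValue (fun j => I.P (clickPath π j) x)
      = 1 + ∑' n, ∏ j ∈ Finset.range (n + 1), I.P (clickPath π j) x := fun x =>
    stayValue_eq_one_add (fun j => (I.P_pos _ _).le) (fun j => hr _ _) hr1
  have hsum : ∀ x, Summable fun n => I.q x * ∏ j ∈ Finset.range (n + 1), I.P (clickPath π j) x :=
    fun x => ((summable_nat_add_iff 1).2
      (summable_stayValue (fun j => (I.P_pos _ _).le) (fun j => hr _ _) hr1)).mul_left _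
  have hnn : ∀ n, 0 ≤ ∑ x, I.q x * ∏ j ∈ Finset.range (n + 1), I.P (clickPath π j) x := fun n =>
    Finset.sum_nonneg fun x _ => mul_nonneg (I.q_nonneg x)
      (Finset.prod_nonneg fun j _ => (I.P_pos _ _).le)
  have hl := lintegral_sum_range (userLaw I) hX fun _ => 1
  simp only [Finset.sum_const, Finset.card_range, nsmul_eq_mul, mul_one, one_mul,
    userLaw_succ_le_policyReturn] at hl
  rw [expectedReturn, integral_eq_lintegral_of_nonneg_ae (ae_of_all _ fun u => by positivity)
    (integrable_policyReturn I hr hr1 π).aestronglyMeasurable]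
  simp only [ENNReal.ofReal_natCast]
  rw [hl, ← ENNReal.ofReal_tsum_of_nonneg hnn (summable_sum fun x _ => hsum x),
    ENNReal.toReal_ofReal (tsum_nonneg hnn), Summable.tsum_finsetSum fun x _ => hsum x, pathValue]
  simp only [hsv, mul_add, mul_one, tsum_mul_left, Finset.sum_add_distrib, I.q_sum]
  ring

theorem exists_isOptimal_threshold (I : BanditInstance) {r : ℝ} (hr : ∀ a x, I.P a x ≤ r)
    (hr1 : r < 1) : ∃ a h, IsOptimal I (thresholdPolicy a h) := by
  obtain ⟨a, h, hah⟩ := exists_threshold_optimal I.P_pos hr hr1 I.q_nonneg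
  refine ⟨a, h, fun π => ?_⟩
  rw [expectedReturn_eq I hr hr1, expectedReturn_eq I hr hr1, clickPath_thresholdPolicy]
  linarith [hah (clickPath π)]

theorem exists_thresholdFamily_ge (I : BanditInstance) {r : ℝ} (hr : ∀ a x, I.P a x ≤ r)
    (hr1 : r < 1) (π : Policy) (H : ℕ) :
    ∃ i, expectedReturn I π ≤ expectedReturn I (thresholdFamily H i) + r ^ H / (1 - r) := by
  obtain ⟨a, h, hah⟩ := exists_threshold_optimal I.P_pos hr hr1 I.q_nonneg
  obtain ⟨a', h', hh', hle⟩ := exists_threshold_le I.P_pos hr hr1 I.q_nonneg H a h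
  refine ⟨(a', ⟨h', by omega⟩), ?_⟩
  rw [I.q_sum, mul_one] at hle
  rw [expectedReturn_eq I hr hr1, expectedReturn_eq I hr hr1, thresholdFamily,
    clickPath_thresholdPolicy]
  linarith [hah (clickPath π)]

theorem expectedReturn_nonneg (I : BanditInstance) (π : Policy) : 0 ≤ expectedReturn I π :=
  integral_nonneg fun _ => by positivity

theorem expectedReturn_le (I : BanditInstance) {r : ℝ} (hr : ∀ a x, I.P a x ≤ r) (hr1 : r < 1)
    (π : Policy) : expectedReturn I π ≤ r / (1 - r) :=
  integral_le_of_geometric_tail (X := fun u : UserType × ClickTable => policyReturn π u.2)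
    (measurable_userReturn π)
    ((I.P_pos 0 0).trans_le (hr 0 0)) hr1 (userLaw_tail_le I hr π)

instance (I : BanditInstance) : IsProbabilityMeasure (streamLaw I) := by
  unfold streamLaw; infer_instance

section Learner

/-- Learner histories carry the discrete `σ`-algebra. -/
@[reducible] def historyMeasurableSpace (ι : Type) : MeasurableSpace (List (ι × ℕ)) := ⊤

attribute [local instance] historyMeasurableSpace

theorem discreteMeasurableSpace_history (ι : Type) : DiscreteMeasurableSpace (List (ι × ℕ)) :=
  ⟨fun _ => trivial⟩

attribute [local instance] discreteMeasurableSpace_history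

variable {ι : Type}

theorem runHistory_length (Pol : ι → Policy) (sel : List (ι × ℕ) → ι)
    (ω : ℕ → UserType × ClickTable) (t : ℕ) : (runHistory Pol sel ω t).length = t := by
  induction t with
  | zero => rfl
  | succ t ih => simp [runHistory, ih]

theorem runHistory_congr (Pol : ι → Policy) (sel : List (ι × ℕ) → ι)
    {ω ω' : ℕ → UserType × ClickTable} {t : ℕ} (h : ∀ s < t, ω s = ω' s) :
    runHistory Pol sel ω t = runHistory Pol sel ω' t := by
  induction t with
  | zero => rfl
  | succ t ih =>
    have h1 := ih fun s hs => h s (hs.trans t.lt_succ_self)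
    simp only [runHistory, h1, h t t.lt_succ_self]

theorem measurable_runHistory [Countable ι] (Pol : ι → Policy) (sel : List (ι × ℕ) → ι) (t : ℕ) :
    Measurable fun ω => runHistory Pol sel ω t := by
  induction t with
  | zero => exact measurable_const
  | succ t ih =>
    have hG : Measurable fun y : List (ι × ℕ) × (UserType × ClickTable) =>
        (sel y.1, policyReturn (Pol (sel y.1)) y.2.2) :: y.1 := by
      refine measurable_from_prod_countable_right fun h => ?_
      have : Measurable fun v : ℕ => (sel h, v) :: h := measurable_from_top
      exact this.comp (measurable_userReturn (Pol (sel h)))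
    exact hG.comp (ih.prodMk (measurable_pi_apply t))

/-- The learner's history after `t` users is independent of user `t`. -/
theorem map_runHistory_prod [Countable ι] (I : BanditInstance) (Pol : ι → Policy)
    (sel : List (ι × ℕ) → ι) (t : ℕ) :
    (streamLaw I).map (fun ω => (runHistory Pol sel ω t, ω t))
      = ((streamLaw I).map fun ω => runHistory Pol sel ω t).prod (userLaw I) := by
  have hind : iIndepFun (fun (i : ℕ) (ω : ℕ → UserType × ClickTable) => ω i) (streamLaw I) :=
    iIndepFun_infinitePi (X := fun _ u => u) fun _ => measurable_id
  have hfin := hind.indepFun_finset (Finset.range t) {t} (by simp) fun i => measurable_pi_apply i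
  let ext : (Finset.range t → UserType × ClickTable) → ℕ → UserType × ClickTable :=
    fun y n => if h : n ∈ Finset.range t then y ⟨n, h⟩ else (0, fun _ => false)
  have hext : Measurable ext := by
    refine measurable_pi_lambda _ fun n => ?_
    by_cases h : n ∈ Finset.range t
    · simpa only [ext, h, dif_pos] using measurable_pi_apply _
    · simp only [ext, h, dif_neg, not_false_eq_true, measurable_const]
  have hcomp := hfin.comp ((measurable_runHistory Pol sel t).comp hext)
    (measurable_pi_apply (⟨t, Finset.mem_singleton_self t⟩ : ({t} : Finset ℕ)))
  have hrun : ((fun ω => runHistory Pol sel ω t) ∘ ext) ∘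
      (fun (ω : ℕ → UserType × ClickTable) (i : Finset.range t) => ω i)
      = fun ω => runHistory Pol sel ω t := by
    ext1 ω
    refine runHistory_congr Pol sel fun s hs => ?_
    simp [ext, hs]
  rw [hrun] at hcomp
  rw [(indepFun_iff_map_prod_eq_prod_map_map (measurable_runHistory Pol sel t).aemeasurable
    (measurable_pi_apply t).aemeasurable).1 hcomp]
  congr 1
  exact Measure.infinitePi_map_eval (fun _ => userLaw I) t

theorem lintegral_runHistory_user [Countable ι] (I : BanditInstance) (Pol : ι → Policy)
    (sel : List (ι × ℕ) → ι) (t : ℕ) {F : List (ι × ℕ) → UserType × ClickTable → ENNReal}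
    (hF : ∀ h, Measurable (F h)) :
    ∫⁻ ω, F (runHistory Pol sel ω t) (ω t) ∂(streamLaw I)
      = ∫⁻ ω, ∫⁻ u, F (runHistory Pol sel ω t) u ∂(userLaw I) ∂(streamLaw I) := by
  have hF' : Measurable fun y : List (ι × ℕ) × (UserType × ClickTable) => F y.1 y.2 :=
    measurable_from_prod_countable_right hF
  rw [← lintegral_map (f := fun y : List (ι × ℕ) × (UserType × ClickTable) => F y.1 y.2) hF'
      ((measurable_runHistory Pol sel t).prodMk (measurable_pi_apply t)),
    map_runHistory_prod, lintegral_prod _ hF'.aemeasurable,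
    lintegral_map (measurable_of_countable _) (measurable_runHistory Pol sel t)]

/-- The return of user `t` is integrable and has the expected return of the selected arm as its
conditional expectation. -/
theorem integrable_return [Finite ι] (I : BanditInstance) {r : ℝ} (hr : ∀ a x, I.P a x ≤ r)
    (hr1 : r < 1) (Pol : ι → Policy) (sel : List (ι × ℕ) → ι) (t : ℕ) :
    Integrable (fun ω => (policyReturn (selectedPolicy Pol sel ω t) (ω t).2 : ℝ)) (streamLaw I) ∧
    ∫ ω, (policyReturn (selectedPolicy Pol sel ω t) (ω t).2 : ℝ) ∂(streamLaw I)
      = ∫ ω, expectedReturn I (selectedPolicy Pol sel ω t) ∂(streamLaw I) := by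
  have hF : Measurable fun y : List (ι × ℕ) × (UserType × ClickTable) =>
      (policyReturn (Pol (sel y.1)) y.2.2 : ℝ) := by
    refine measurable_from_prod_countable_right fun h => ?_
    have : Measurable fun v : ℕ => (v : ℝ) := measurable_from_top
    exact this.comp (measurable_userReturn (Pol (sel h)))
  have hm := (measurable_runHistory Pol sel t).prodMk
    (measurable_pi_apply (X := fun _ : ℕ => UserType × ClickTable) t)
  have hr0 : 0 < r := (I.P_pos 0 0).trans_le (hr 0 0)
  have hprob : IsProbabilityMeasure ((streamLaw I).map fun ω => runHistory Pol sel ω t) :=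
    Measure.isProbabilityMeasure_map (measurable_runHistory Pol sel t).aemeasurable
  have hint : Integrable (fun y : List (ι × ℕ) × (UserType × ClickTable) =>
      (policyReturn (Pol (sel y.1)) y.2.2 : ℝ))
      (((streamLaw I).map fun ω => runHistory Pol sel ω t).prod (userLaw I)) := by
    rw [integrable_prod_iff hF.aestronglyMeasurable]
    refine ⟨ae_of_all _ fun h => integrable_policyReturn I hr hr1 (Pol (sel h)), ?_⟩
    refine Integrable.of_bound (measurable_of_countable _).aestronglyMeasurable (r / (1 - r))
      (ae_of_all _ fun h => ?_)
    simp only [Real.norm_natCast]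
    exact (Real.norm_of_nonneg (expectedReturn_nonneg I (Pol (sel h)))).trans_le
      (expectedReturn_le I hr hr1 (Pol (sel h)))
  have hint' := hint
  rw [← map_runHistory_prod] at hint'
  refine ⟨hint'.comp_measurable hm, ?_⟩
  calc _ = ∫ y, (policyReturn (Pol (sel y.1)) y.2.2 : ℝ)
        ∂((streamLaw I).map fun ω => (runHistory Pol sel ω t, ω t)) :=
        (integral_map hm.aemeasurable hF.aestronglyMeasurable).symm
    _ = ∫ h, expectedReturn I (Pol (sel h)) ∂((streamLaw I).map fun ω => runHistory Pol sel ω t) := by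
        rw [map_runHistory_prod, integral_prod _ hint]; rfl
    _ = _ := integral_map (measurable_runHistory Pol sel t).aemeasurable
        (measurable_of_countable _).aestronglyMeasurable

/-- Integrability of the regret, and its expectation in terms of the expected returns of the
selected policies. -/
theorem integrable_regret [Finite ι] (I : BanditInstance) {r : ℝ} (hr : ∀ a x, I.P a x ≤ r)
    (hr1 : r < 1) (πstar : Policy) (Pol : ι → Policy) (sel : List (ι × ℕ) → ι) (T : ℕ) :
    Integrable (regret I πstar Pol sel T) (streamLaw I) ∧
    ∫ ω, regret I πstar Pol sel T ω ∂(streamLaw I)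
      = T * expectedReturn I πstar
        - ∑ t ∈ Finset.range T, ∫ ω, expectedReturn I (selectedPolicy Pol sel ω t) ∂(streamLaw I) := by
  have hint := integrable_finsetSum (Finset.range T) fun t _ =>
    (integrable_return I hr hr1 Pol sel t).1
  refine ⟨(integrable_const _).sub hint, ?_⟩
  unfold regret
  rw [integral_sub (integrable_const _) hint,
    integral_finsetSum _ fun t _ => (integrable_return I hr hr1 Pol sel t).1]
  simp [fun t => (integrable_return I hr hr1 Pol sel t).2]

/-- The expected regret is at most `T` times the optimal expected return. -/
theorem integral_regret_le_mul [Finite ι] (I : BanditInstance) {r : ℝ} (hr : ∀ a x, I.P a x ≤ r)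
    (hr1 : r < 1) (πstar : Policy) (Pol : ι → Policy) (sel : List (ι × ℕ) → ι) (T : ℕ) :
    ∫ ω, regret I πstar Pol sel T ω ∂(streamLaw I) ≤ T * (r / (1 - r)) := by
  rw [(integrable_regret I hr hr1 πstar Pol sel T).2]
  have h1 : 0 ≤ ∑ t ∈ Finset.range T,
      ∫ ω, expectedReturn I (selectedPolicy Pol sel ω t) ∂(streamLaw I) :=
    Finset.sum_nonneg fun t _ => integral_nonneg fun ω => expectedReturn_nonneg I _
  have h2 := mul_le_mul_of_nonneg_left (expectedReturn_le I hr hr1 πstar) (Nat.cast_nonneg (α := ℝ) T)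
  linarith

variable [DecidableEq ι]

theorem pulls_cons (e : ι × ℕ) (h : List (ι × ℕ)) (i : ι) :
    pulls (e :: h) i = pulls h i + if e.1 = i then 1 else 0 := by
  by_cases he : e.1 = i <;> simp [pulls, he]

theorem returnSum_cons (e : ι × ℕ) (h : List (ι × ℕ)) (i : ι) :
    returnSum (e :: h) i = returnSum h i + if e.1 = i then e.2 else 0 := by
  by_cases he : e.1 = i <;> simp [returnSum, he, add_comm]

theorem pulls_le_length (h : List (ι × ℕ)) (i : ι) : pulls h i ≤ h.length :=
  List.length_filter_le _ _

theorem sum_pulls [Fintype ι] (h : List (ι × ℕ)) : ∑ i, pulls h i = h.length := by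
  induction h with
  | nil => simp [pulls]
  | cons e h ih => simp [pulls_cons, Finset.sum_add_distrib, ih]

/-- The exponential supermartingale of arm `i`. -/
theorem lintegral_exp_runHistory_le [Countable ι] (I : BanditInstance) {r : ℝ}
    (hr : ∀ a x, I.P a x ≤ r) (hr1 : r < 1) (Pol : ι → Policy) (sel : List (ι × ℕ) → ι) (i : ι)
    {τ c : ℝ} (hτ : τ = 8 * Real.exp 1 / Real.log (1 / r)) (hc : |c| ≤ 1 / τ) (t : ℕ) :
    ∫⁻ ω, ENNReal.ofReal (Real.exp
      (c * (returnSum (runHistory Pol sel ω t) i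
          - pulls (runHistory Pol sel ω t) i * expectedReturn I (Pol i))
        - pulls (runHistory Pol sel ω t) i * (c ^ 2 * τ ^ 2 / 2))) ∂(streamLaw I) ≤ 1 := by
  induction t with
  | zero => simp [runHistory, pulls, returnSum]
  | succ t ih =>
    refine le_trans ?_ ih
    let F : List (ι × ℕ) → UserType × ClickTable → ENNReal := fun h u =>
      ENNReal.ofReal (Real.exp
        (c * (returnSum ((sel h, policyReturn (Pol (sel h)) u.2) :: h) i
          - pulls ((sel h, policyReturn (Pol (sel h)) u.2) :: h) i * expectedReturn I (Pol i))
        - pulls ((sel h, policyReturn (Pol (sel h)) u.2) :: h) i * (c ^ 2 * τ ^ 2 / 2)))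
    have hF : ∀ h, Measurable (F h) := fun h => by
      have : Measurable fun v : ℕ => ENNReal.ofReal (Real.exp
          (c * (returnSum ((sel h, v) :: h) i
            - pulls ((sel h, v) :: h) i * expectedReturn I (Pol i))
          - pulls ((sel h, v) :: h) i * (c ^ 2 * τ ^ 2 / 2))) := measurable_from_top
      exact this.comp (measurable_userReturn (Pol (sel h)))
    have hmain := lintegral_runHistory_user I Pol sel t hF
    change ∫⁻ ω, F (runHistory Pol sel ω t) (ω t) ∂(streamLaw I) ≤ _
    rw [hmain]
    refine lintegral_mono fun ω => ?_
    set h := runHistory Pol sel ω t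
    by_cases hi : sel h = i
    · have hFeq : ∀ u, F h u = ENNReal.ofReal (Real.exp
          (c * (returnSum h i - pulls h i * expectedReturn I (Pol i))
            - pulls h i * (c ^ 2 * τ ^ 2 / 2)) * Real.exp (-(c ^ 2 * τ ^ 2 / 2)))
          * ENNReal.ofReal (Real.exp (c * (policyReturn (Pol i) u.2 - expectedReturn I (Pol i)))) := by
        intro u
        rw [← ENNReal.ofReal_mul (by positivity), ← Real.exp_add, ← Real.exp_add]
        simp only [F, pulls_cons, returnSum_cons, hi, if_true]
        congr 2
        push_cast
        ring
      simp_rw [hFeq]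
      rw [lintegral_const_mul']
      swap
      · exact ENNReal.ofReal_ne_top
      have hsub := lintegral_exp_centered_le (μ := userLaw I)
        (X := fun u : UserType × ClickTable => policyReturn (Pol i) u.2)
        (measurable_userReturn (Pol i))
        ((I.P_pos 0 0).trans_le (hr 0 0)) hr1 (userLaw_tail_le I hr (Pol i)) hτ hc
      refine (mul_le_mul_right hsub _).trans ?_
      rw [← ENNReal.ofReal_mul (by positivity), mul_assoc, ← Real.exp_add, neg_add_cancel,
        Real.exp_zero, mul_one]
    · have hFeq : ∀ u, F h u = ENNReal.ofReal (Real.exp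
          (c * (returnSum h i - pulls h i * expectedReturn I (Pol i))
            - pulls h i * (c ^ 2 * τ ^ 2 / 2))) := by
        intro u
        simp only [F, pulls_cons, returnSum_cons, hi, if_false, add_zero]
      simp_rw [hFeq]
      simp

theorem measure_deviation_le [Countable ι] (I : BanditInstance) {r : ℝ}
    (hr : ∀ a x, I.P a x ≤ r) (hr1 : r < 1) (Pol : ι → Policy) (sel : List (ι × ℕ) → ι) (i : ι)
    {τ c : ℝ} (hτ : τ = 8 * Real.exp 1 / Real.log (1 / r)) (hc : |c| ≤ 1 / τ) (t n : ℕ) (a : ℝ) :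
    streamLaw I {ω | pulls (runHistory Pol sel ω t) i = n ∧
      a ≤ c * (returnSum (runHistory Pol sel ω t) i - n * expectedReturn I (Pol i))}
      ≤ ENNReal.ofReal (Real.exp (-(a - n * (c ^ 2 * τ ^ 2 / 2)))) := by
  set b := a - n * (c ^ 2 * τ ^ 2 / 2) with hb
  let G : List (ι × ℕ) → ENNReal := fun h => ENNReal.ofReal (Real.exp
    (c * (returnSum h i - pulls h i * expectedReturn I (Pol i)) - pulls h i * (c ^ 2 * τ ^ 2 / 2)))
  have hmk := mul_meas_ge_le_lintegral (μ := streamLaw I)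
    (f := fun ω => G (runHistory Pol sel ω t))
    ((measurable_of_countable G).comp (measurable_runHistory Pol sel t)) (ENNReal.ofReal (Real.exp b))
  have h1 := hmk.trans (lintegral_exp_runHistory_le I hr hr1 Pol sel i hτ hc t)
  have hsub : {ω | pulls (runHistory Pol sel ω t) i = n ∧
      a ≤ c * (returnSum (runHistory Pol sel ω t) i - n * expectedReturn I (Pol i))}
      ⊆ {ω | ENNReal.ofReal (Real.exp b) ≤ G (runHistory Pol sel ω t)} := by
    rintro ω ⟨hn, ha⟩
    refine ENNReal.ofReal_le_ofReal (Real.exp_le_exp.2 ?_)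
    rw [hn, hb]
    linarith
  refine (measure_mono hsub).trans ?_
  rw [Real.exp_neg, ENNReal.ofReal_inv_of_pos (Real.exp_pos _)]
  rw [← one_div, ENNReal.le_div_iff_mul_le (by simp [Real.exp_pos]) (by simp), mul_comm]
  exact h1

/-- The hybrid confidence radius after `n` executions. -/
noncomputable def hybridRadius (T : ℕ) (τ : ℝ) (n : ℕ) : ℝ :=
  if (n : ℝ) < 8 * Real.log T then 8 * τ * Real.log T / n
  else Real.sqrt (8 * τ ^ 2 * Real.log T / n)

theorem ucbIndex_eq (T : ℕ) (τ : ℝ) (h : List (ι × ℕ)) (i : ι) (hi : pulls h i ≠ 0) :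
    ucbIndex T τ 1 h i
      = (((returnSum h i : ℝ) / pulls h i + hybridRadius T τ (pulls h i) : ℝ) : EReal) := by
  unfold ucbIndex hybridRadius
  rw [if_neg hi]
  simp only [mul_one, Real.sqrt_one]
  split_ifs <;> rfl

theorem exists_chernoff_parameter {T n : ℕ} {τ : ℝ} (hT : 2 ≤ T) (hn : 1 ≤ n) (hτ : 0 < τ) :
    ∃ c, 0 < c ∧ c ≤ 1 / τ ∧
      4 * Real.log T ≤ c * (n * hybridRadius T τ n) - n * (c ^ 2 * τ ^ 2 / 2) := by
  have hlog : 0 < Real.log T := Real.log_pos (by exact_mod_cast hT)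
  have hn0 : (0 : ℝ) < n := by exact_mod_cast hn
  unfold hybridRadius
  split_ifs with hlt
  · refine ⟨1 / τ, by positivity, le_rfl, ?_⟩
    have : 1 / τ * (n * (8 * τ * Real.log T / n)) - n * ((1 / τ) ^ 2 * τ ^ 2 / 2)
        = 8 * Real.log T - n / 2 := by field_simp
    rw [this]; linarith
  · push Not at hlt
    set s := Real.sqrt (8 * τ ^ 2 * Real.log T / n) with hs
    have hs2 : s ^ 2 = 8 * τ ^ 2 * Real.log T / n := Real.sq_sqrt (by positivity)
    have hs0 : 0 < s := Real.sqrt_pos.2 (by positivity)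
    have hsτ : s ≤ τ := by
      refine Real.sqrt_le_iff.2 ⟨hτ.le, ?_⟩
      rw [div_le_iff₀ hn0]
      nlinarith [sq_nonneg τ]
    refine ⟨s / τ ^ 2, by positivity, ?_, le_of_eq ?_⟩
    · rw [div_le_div_iff₀ (by positivity) hτ]; nlinarith
    · have : s / τ ^ 2 * (n * s) - n * ((s / τ ^ 2) ^ 2 * τ ^ 2 / 2) = n * s ^ 2 / (2 * τ ^ 2) := by
        field_simp; ring
      rw [this, hs2]; field_simp; ring

/-- The histories in which the average return of some arm lies outside its confidence interval. -/
def IsMisleading (μ : ι → ℝ) (T : ℕ) (τ : ℝ) (h : List (ι × ℕ)) : Prop :=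
  ∃ i, pulls h i ≠ 0 ∧
    hybridRadius T τ (pulls h i) ≤ |(returnSum h i : ℝ) / pulls h i - μ i|

theorem measure_isMisleading_le [Fintype ι] (I : BanditInstance) {r : ℝ}
    (hr : ∀ a x, I.P a x ≤ r) (hr1 : r < 1) (Pol : ι → Policy) (sel : List (ι × ℕ) → ι)
    {τ : ℝ} (hτ : τ = 8 * Real.exp 1 / Real.log (1 / r)) {T t : ℕ} (hT : 2 ≤ T) (ht : t ≤ T) :
    (streamLaw I).real
      {ω | IsMisleading (fun i => expectedReturn I (Pol i)) T τ (runHistory Pol sel ω t)}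
      ≤ Fintype.card ι * (T * (2 * Real.exp (-(4 * Real.log T)))) := by
  have hr0 : 0 < r := (I.P_pos 0 0).trans_le (hr 0 0)
  have hτ0 : 0 < τ := by
    rw [hτ]
    have : 0 < Real.log (1 / r) := Real.log_pos ((one_lt_div hr0).2 hr1)
    positivity
  set δ := ENNReal.ofReal (Real.exp (-(4 * Real.log T))) with hδ
  have hstep : ∀ i, ∀ n ∈ Finset.Icc 1 T, streamLaw I
      {ω | pulls (runHistory Pol sel ω t) i = n ∧ hybridRadius T τ n
        ≤ |(returnSum (runHistory Pol sel ω t) i : ℝ) / n - expectedReturn I (Pol i)|} ≤ 2 * δ := by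
    intro i n hn
    have hn1 : 1 ≤ n := (Finset.mem_Icc.1 hn).1
    have hn0 : (0 : ℝ) < n := by exact_mod_cast hn1
    obtain ⟨c, hc0, hcτ, hc4⟩ := exists_chernoff_parameter hT hn1 hτ0
    set a := c * (n * hybridRadius T τ n) with ha
    have key : ∀ c', c' ^ 2 = c ^ 2 → |c'| ≤ 1 / τ → streamLaw I
        {ω | pulls (runHistory Pol sel ω t) i = n ∧
          a ≤ c' * (returnSum (runHistory Pol sel ω t) i - n * expectedReturn I (Pol i))} ≤ δ := by
      intro c' h1 h2
      refine (measure_deviation_le I hr hr1 Pol sel i hτ h2 t n a).trans ?_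
      refine ENNReal.ofReal_le_ofReal (Real.exp_le_exp.2 ?_)
      rw [h1]; linarith
    have k1 := key c rfl (by rwa [abs_of_pos hc0])
    have k2 := key (-c) (by ring) (by rwa [abs_neg, abs_of_pos hc0])
    have hsub : {ω | pulls (runHistory Pol sel ω t) i = n ∧ hybridRadius T τ n
        ≤ |(returnSum (runHistory Pol sel ω t) i : ℝ) / n - expectedReturn I (Pol i)|}
        ⊆ {ω | pulls (runHistory Pol sel ω t) i = n ∧
          a ≤ c * (returnSum (runHistory Pol sel ω t) i - n * expectedReturn I (Pol i))} ∪
          {ω | pulls (runHistory Pol sel ω t) i = n ∧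
          a ≤ -c * (returnSum (runHistory Pol sel ω t) i - n * expectedReturn I (Pol i))} := by
      rintro ω ⟨hω, hdev⟩
      set S := (returnSum (runHistory Pol sel ω t) i : ℝ)
      set m := expectedReturn I (Pol i)
      have e : S - n * m = n * (S / n - m) := by field_simp
      have hcn : 0 ≤ c * n := by positivity
      rcases le_abs.1 hdev with h | h
      · left
        refine ⟨hω, ?_⟩
        change a ≤ c * (S - n * m)
        rw [e, ha]
        gcongr
      · right
        refine ⟨hω, ?_⟩
        change a ≤ -c * (S - n * m)
        rw [e, ha]
        have := mul_le_mul_of_nonneg_left h hcn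
        linarith
    refine (measure_mono hsub).trans ((measure_union_le _ _).trans ?_)
    rw [two_mul]
    exact add_le_add k1 k2
  have hsub : {ω | IsMisleading (fun i => expectedReturn I (Pol i)) T τ (runHistory Pol sel ω t)}
      ⊆ ⋃ i ∈ (Finset.univ : Finset ι), ⋃ n ∈ Finset.Icc 1 T,
        {ω | pulls (runHistory Pol sel ω t) i = n ∧ hybridRadius T τ n
        ≤ |(returnSum (runHistory Pol sel ω t) i : ℝ) / n - expectedReturn I (Pol i)|} := by
    rintro ω ⟨i, hi, hdev⟩
    have hle : pulls (runHistory Pol sel ω t) i ≤ T :=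
      (pulls_le_length _ i).trans (by rwa [runHistory_length])
    simp only [Set.mem_iUnion]
    exact ⟨i, Finset.mem_univ i, _, Finset.mem_Icc.2 ⟨Nat.one_le_iff_ne_zero.2 hi, hle⟩, rfl, hdev⟩
  have hbound : streamLaw I
      {ω | IsMisleading (fun i => expectedReturn I (Pol i)) T τ (runHistory Pol sel ω t)}
      ≤ Fintype.card ι * (T * (2 * δ)) := by
    refine (measure_mono hsub).trans ((measure_biUnion_finset_le _ _).trans ?_)
    refine (Finset.sum_le_sum fun i _ => (measure_biUnion_finset_le _ _).trans
      (Finset.sum_le_sum (hstep i))).trans ?_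
    simp
  have hfin : (Fintype.card ι * (T * (2 * δ)) : ENNReal)
      = ENNReal.ofReal (Fintype.card ι * (T * (2 * Real.exp (-(4 * Real.log T))))) := by
    rw [ENNReal.ofReal_mul (by positivity), ENNReal.ofReal_mul (by positivity),
      ENNReal.ofReal_mul (by positivity)]
    simp [hδ]
  rw [hfin] at hbound
  exact ENNReal.toReal_le_of_le_ofReal (by positivity) hbound

/-- The regret budget of an arm that has been executed `n` times. -/
noncomputable def armBudget (B : ℝ) (T : ℕ) (τ : ℝ) (n : ℕ) : ℝ :=
  B * min n (⌈8 * Real.log T⌉₊ + 1) + 6 * (Real.sqrt (8 * τ ^ 2 * Real.log T) * Real.sqrt n)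

theorem armBudget_mono {B : ℝ} (hB : 0 ≤ B) (T : ℕ) (τ : ℝ) (n : ℕ) :
    armBudget B T τ n ≤ armBudget B T τ (n + 1) := by
  unfold armBudget
  push_cast
  refine add_le_add (mul_le_mul_of_nonneg_left ?_ hB) ?_ <;> gcongr <;> linarith

theorem le_armBudget_sub (B : ℝ) {T n : ℕ} (τ : ℝ)
    (h : (n : ℝ) < 8 * Real.log T ∨ n = 0) :
    B ≤ armBudget B T τ (n + 1) - armBudget B T τ n := by
  have hlt : n < ⌈8 * Real.log T⌉₊ + 1 := by
    rcases h with h | h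
    · exact Nat.lt_succ_of_lt (Nat.lt_ceil.2 h)
    · omega
  have hlt' : (n : ℝ) + 1 ≤ ⌈8 * Real.log T⌉₊ + 1 := by exact_mod_cast hlt
  unfold armBudget
  push_cast
  rw [min_eq_left hlt', min_eq_left (by linarith)]
  have : Real.sqrt n ≤ Real.sqrt (n + 1) := Real.sqrt_le_sqrt (by linarith)
  have := mul_le_mul_of_nonneg_left this (Real.sqrt_nonneg (8 * τ ^ 2 * Real.log T))
  linarith

theorem two_mul_hybridRadius_le {B : ℝ} (hB : 0 ≤ B) {T n : ℕ} (τ : ℝ) (hn : 1 ≤ n)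
    (h : 8 * Real.log T ≤ n) :
    2 * hybridRadius T τ n ≤ armBudget B T τ (n + 1) - armBudget B T τ n := by
  have hn0 : (1 : ℝ) ≤ n := by exact_mod_cast hn
  rw [hybridRadius, if_neg (not_lt.2 h), Real.sqrt_div' _ (by positivity)]
  unfold armBudget
  push_cast
  set s := Real.sqrt (8 * τ ^ 2 * Real.log T) with hs
  have hs0 : 0 ≤ s := Real.sqrt_nonneg _
  set x := Real.sqrt n with hx
  set y := Real.sqrt ((n : ℝ) + 1) with hy
  have hx2 : x ^ 2 = n := Real.sq_sqrt (by positivity)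
  have hy2 : y ^ 2 = n + 1 := Real.sq_sqrt (by positivity)
  have hx1 : 1 ≤ x := Real.one_le_sqrt.2 hn0
  have hy0 : 0 ≤ y := Real.sqrt_nonneg _
  have hyx : y ≤ 2 * x := by
    rw [hy]
    refine Real.sqrt_le_iff.2 ⟨by positivity, ?_⟩
    nlinarith
  have h1 : 1 / (3 * x) ≤ y - x := by
    rw [div_le_iff₀ (by positivity)]
    have hxy : x ≤ y := Real.sqrt_le_sqrt (by linarith)
    nlinarith
  have hmin : min (n : ℝ) (⌈8 * Real.log T⌉₊ + 1) ≤ min ((n : ℝ) + 1) (⌈8 * Real.log T⌉₊ + 1) := by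
    gcongr; linarith
  have h2 := mul_le_mul_of_nonneg_left hmin hB
  have h3 := mul_le_mul_of_nonneg_left h1 hs0
  have h4 : 2 * (s / x) = 6 * (s * (1 / (3 * x))) := by field_simp; ring
  rw [h4]
  linarith

/-- Outside misleading histories, the gap of the selected arm is paid for by the increase of its
budget. -/
theorem gap_le_armBudget_sub {B : ℝ} (hB : 0 ≤ B) {μ : ι → ℝ} (hμ0 : ∀ i, 0 ≤ μ i)
    (hμB : ∀ i, μ i ≤ B) {T : ℕ} {τ : ℝ} {sel : List (ι × ℕ) → ι} (hsel : IsUCBHybrid T τ 1 sel)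
    {h : List (ι × ℕ)} (hgood : ¬ IsMisleading μ T τ h) (j : ι) :
    μ j - μ (sel h) ≤ armBudget B T τ (pulls h (sel h) + 1) - armBudget B T τ (pulls h (sel h)) := by
  set n := pulls h (sel h) with hn
  by_cases hsmall : (n : ℝ) < 8 * Real.log T ∨ n = 0
  · linarith [le_armBudget_sub B τ hsmall, hμ0 (sel h), hμB j]
  push Not at hsmall
  refine le_trans ?_ (two_mul_hybridRadius_le hB τ (Nat.one_le_iff_ne_zero.2 hsmall.2) hsmall.1)
  have hidx := hsel h j
  rw [ucbIndex_eq T τ h (sel h) hsmall.2] at hidx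
  have hj : pulls h j ≠ 0 := by
    intro hj
    rw [ucbIndex, if_pos hj] at hidx
    exact absurd (top_le_iff.1 hidx) (EReal.coe_ne_top _)
  rw [ucbIndex_eq T τ h j hj, EReal.coe_le_coe_iff] at hidx
  simp only [IsMisleading, not_exists, not_and, not_le] at hgood
  have h1 := (abs_lt.1 (hgood j hj)).1
  have h2 := (abs_lt.1 (hgood (sel h) hsmall.2)).2
  linarith

theorem sum_gap_le [Fintype ι] {B : ℝ} (hB : 0 ≤ B) {μ : ι → ℝ} (hμ0 : ∀ i, 0 ≤ μ i)
    (hμB : ∀ i, μ i ≤ B) {T : ℕ} {τ : ℝ} {sel : List (ι × ℕ) → ι} (hsel : IsUCBHybrid T τ 1 sel)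
    (Pol : ι → Policy) (ω : ℕ → UserType × ClickTable) (j : ι) (t : ℕ) :
    ∑ s ∈ Finset.range t, (μ j - μ (sel (runHistory Pol sel ω s)))
      ≤ ∑ i, armBudget B T τ (pulls (runHistory Pol sel ω t) i)
        + ∑ s ∈ Finset.range t,
          {h | IsMisleading μ T τ h}.indicator (fun _ => B) (runHistory Pol sel ω s) := by
  induction t with
  | zero => simp [runHistory, pulls, armBudget]
  | succ t ih =>
    rw [Finset.sum_range_succ, Finset.sum_range_succ]
    set h := runHistory Pol sel ω t with hh
    have hstep : ∑ i, armBudget B T τ (pulls (runHistory Pol sel ω (t + 1)) i)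
        = ∑ i, armBudget B T τ (pulls h i)
          + (armBudget B T τ (pulls h (sel h) + 1) - armBudget B T τ (pulls h (sel h))) := by
      rw [← sub_eq_iff_eq_add', ← Finset.sum_sub_distrib]
      rw [Finset.sum_eq_single (sel h)]
      · simp [runHistory, pulls_cons, ← hh]
      · intro i _ hi
        simp [runHistory, pulls_cons, ← hh, Ne.symm hi]
      · simp
    have hgap : μ j - μ (sel h)
        ≤ (armBudget B T τ (pulls h (sel h) + 1) - armBudget B T τ (pulls h (sel h)))
          + {h | IsMisleading μ T τ h}.indicator (fun _ => B) h := by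
      by_cases hbad : IsMisleading μ T τ h
      · rw [Set.indicator_of_mem (show h ∈ {h | IsMisleading μ T τ h} from hbad)]
        linarith [armBudget_mono hB T τ (pulls h (sel h)), hμ0 (sel h), hμB j]
      · rw [Set.indicator_of_notMem (show h ∉ {h | IsMisleading μ T τ h} from hbad), add_zero]
        exact gap_le_armBudget_sub hB hμ0 hμB hsel hbad j
    linarith

theorem sum_armBudget_le [Fintype ι] {B : ℝ} (hB : 0 ≤ B) {T : ℕ} (hT : 1 ≤ T) (τ : ℝ)
    {h : List (ι × ℕ)} (hlen : h.length = T) :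
    ∑ i, armBudget B T τ (pulls h i)
      ≤ Fintype.card ι * (B * (8 * Real.log T + 2))
        + 6 * (Real.sqrt (8 * τ ^ 2 * Real.log T) * Real.sqrt (Fintype.card ι * T)) := by
  have hlog : 0 ≤ Real.log T := Real.log_nonneg (by exact_mod_cast hT)
  have hceil := (Nat.ceil_lt_add_one (a := 8 * Real.log T) (by positivity)).le
  simp only [armBudget, Finset.sum_add_distrib, ← Finset.mul_sum]
  push_cast
  refine add_le_add ?_ ?_
  · rw [mul_left_comm]
    refine mul_le_mul_of_nonneg_left ?_ hB
    calc ∑ i, min (pulls h i : ℝ) (⌈8 * Real.log T⌉₊ + 1) ≤ ∑ _i : ι, (8 * Real.log T + 2) :=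
          Finset.sum_le_sum fun i _ => (min_le_right _ _).trans (by linarith)
      _ = _ := by simp; ring
  · gcongr
    refine Real.le_sqrt_of_sq_le ?_
    have hcs := sq_sum_le_card_mul_sum_sq (s := (Finset.univ : Finset ι))
      (f := fun i => Real.sqrt (pulls h i))
    refine hcs.trans (le_of_eq ?_)
    simp only [Real.sq_sqrt (Nat.cast_nonneg _)]
    rw [← Nat.cast_sum, sum_pulls, hlen, Finset.card_univ]

/-- The regret bound of UCB-Hybrid in terms of the number of arms. -/
theorem integral_regret_le [Fintype ι] (I : BanditInstance) {r : ℝ} (hr : ∀ a x, I.P a x ≤ r)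
    (hr1 : r < 1) {τ B : ℝ} (hτ : τ = 8 * Real.exp 1 / Real.log (1 / r)) (hB : B = r / (1 - r))
    (πstar : Policy) (Pol : ι → Policy) {sel : List (ι × ℕ) → ι} {T : ℕ} (hT : 2 ≤ T)
    (hsel : IsUCBHybrid T τ 1 sel) (j : ι) :
    ∫ ω, regret I πstar Pol sel T ω ∂(streamLaw I)
      ≤ T * (expectedReturn I πstar - expectedReturn I (Pol j))
        + (Fintype.card ι * (B * (8 * Real.log T + 2))
          + 6 * (Real.sqrt (8 * τ ^ 2 * Real.log T) * Real.sqrt (Fintype.card ι * T)))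
        + 2 * Fintype.card ι * B := by
  have hr0 : 0 < r := (I.P_pos 0 0).trans_le (hr 0 0)
  have hB0 : 0 ≤ B := by rw [hB]; exact div_nonneg hr0.le (by linarith)
  set μ : ι → ℝ := fun i => expectedReturn I (Pol i) with hμ
  have hμ0 : ∀ i, 0 ≤ μ i := fun i => expectedReturn_nonneg I _
  have hμB : ∀ i, μ i ≤ B := fun i => hB ▸ expectedReturn_le I hr hr1 _
  set Q := Fintype.card ι * (B * (8 * Real.log T + 2))
          + 6 * (Real.sqrt (8 * τ ^ 2 * Real.log T) * Real.sqrt (Fintype.card ι * T)) with hQ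
  have hmeas : ∀ (f : List (ι × ℕ) → ℝ) t, Measurable fun ω => f (runHistory Pol sel ω t) :=
    fun f t => (measurable_of_countable f).comp (measurable_runHistory Pol sel t)
  have hint1 : ∀ t, Integrable (fun ω => μ (sel (runHistory Pol sel ω t))) (streamLaw I) := fun t =>
    Integrable.of_bound (hmeas (fun h => μ (sel h)) t).aestronglyMeasurable B
      (ae_of_all _ fun ω => by rw [Real.norm_of_nonneg (hμ0 _)]; exact hμB _)
  have hint2 : ∀ t, Integrable (fun ω =>
      {h | IsMisleading μ T τ h}.indicator (fun _ => B) (runHistory Pol sel ω t)) (streamLaw I) :=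
    fun t => Integrable.of_bound (hmeas _ t).aestronglyMeasurable B (ae_of_all _ fun ω => by
      refine (norm_indicator_le_norm_self _ _).trans ?_
      rw [Real.norm_of_nonneg hB0])
  have hval : ∀ t ≤ T, ∫ ω, {h | IsMisleading μ T τ h}.indicator (fun _ => B)
      (runHistory Pol sel ω t) ∂(streamLaw I)
      ≤ Fintype.card ι * (T * (2 * Real.exp (-(4 * Real.log T)))) * B := by
    intro t ht
    have hset : MeasurableSet {ω | IsMisleading μ T τ (runHistory Pol sel ω t)} :=
      measurable_runHistory Pol sel t (MeasurableSet.of_discrete (s := {h | IsMisleading μ T τ h}))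
    have heq : (fun ω => {h | IsMisleading μ T τ h}.indicator (fun _ => B) (runHistory Pol sel ω t))
        = {ω | IsMisleading μ T τ (runHistory Pol sel ω t)}.indicator fun _ => B := rfl
    rw [heq, integral_indicator_const _ hset, smul_eq_mul]
    exact mul_le_mul_of_nonneg_right (measure_isMisleading_le I hr hr1 Pol sel hτ hT ht) hB0
  have hpath : ∀ ω, ∑ t ∈ Finset.range T, (μ j - μ (sel (runHistory Pol sel ω t)))
      ≤ Q + ∑ t ∈ Finset.range T,
        {h | IsMisleading μ T τ h}.indicator (fun _ => B) (runHistory Pol sel ω t) := fun ω =>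
    (sum_gap_le hB0 hμ0 hμB hsel Pol ω j T).trans (by
      gcongr
      exact sum_armBudget_le hB0 (by omega) τ (runHistory_length Pol sel ω T))
  have hint3 : ∀ t, Integrable (fun ω => μ j - μ (sel (runHistory Pol sel ω t))) (streamLaw I) :=
    fun t => (integrable_const _).sub (hint1 t)
  have hint4 : Integrable (fun ω => Q + ∑ t ∈ Finset.range T,
      {h | IsMisleading μ T τ h}.indicator (fun _ => B) (runHistory Pol sel ω t)) (streamLaw I) :=
    (integrable_const _).add (integrable_finsetSum _ fun t _ => hint2 t)
  have hI := integral_mono (integrable_finsetSum (Finset.range T) fun t _ => hint3 t) hint4 hpath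
  have hL : ∫ ω, ∑ t ∈ Finset.range T, (μ j - μ (sel (runHistory Pol sel ω t))) ∂(streamLaw I)
      = T * μ j - ∑ t ∈ Finset.range T, ∫ ω, μ (sel (runHistory Pol sel ω t)) ∂(streamLaw I) := by
    rw [integral_finsetSum _ fun t _ => hint3 t]
    simp_rw [fun t => integral_sub (integrable_const (μ j)) (hint1 t)]
    simp
  have hR : ∫ ω, (Q + ∑ t ∈ Finset.range T, {h | IsMisleading μ T τ h}.indicator (fun _ => B)
      (runHistory Pol sel ω t)) ∂(streamLaw I)
      ≤ Q + T * (Fintype.card ι * (T * (2 * Real.exp (-(4 * Real.log T)))) * B) := by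
    rw [integral_add (integrable_const Q) (integrable_finsetSum _ fun t _ => hint2 t),
      integral_finsetSum _ fun t _ => hint2 t]
    simp only [integral_const, probReal_univ, one_smul]
    gcongr
    refine (Finset.sum_le_sum fun t ht => hval t (Finset.mem_range.1 ht).le).trans ?_
    simp
  have hexp : (T : ℝ) * T * Real.exp (-(4 * Real.log T)) ≤ 1 := by
    have hT1 : (1 : ℝ) ≤ T := by exact_mod_cast (by omega : 1 ≤ T)
    rw [Real.exp_neg, mul_inv_le_iff₀ (Real.exp_pos _), one_mul, mul_comm 4, Real.exp_mul,
      Real.exp_log (by linarith)]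
    norm_cast
    rw [← pow_two]
    exact Nat.pow_le_pow_right (by omega) (by norm_num)
  have hlast : T * (Fintype.card ι * (T * (2 * Real.exp (-(4 * Real.log T)))) * B)
      ≤ 2 * Fintype.card ι * B := by
    have := mul_le_mul_of_nonneg_left hexp (by positivity : 0 ≤ 2 * (Fintype.card ι : ℝ) * B)
    linarith
  rw [(integrable_regret I hr hr1 πstar Pol sel T).2]
  rw [hL] at hI
  have hI' := hI.trans hR
  have hsame : ∑ t ∈ Finset.range T, ∫ ω, expectedReturn I (selectedPolicy Pol sel ω t) ∂(streamLaw I)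
      = ∑ t ∈ Finset.range T, ∫ ω, μ (sel (runHistory Pol sel ω t)) ∂(streamLaw I) := rfl
  rw [hsame]
  have hj : expectedReturn I (Pol j) = μ j := rfl
  rw [hj]
  linarith

end Learner
/-- The constant of the regret bound when at most `A * log T` policies are used, the best of them
loses at most `G * √T * log T`, and both hold from `T = N` on. -/
noncomputable def regretConstant (ε A G : ℝ) (N : ℕ) : ℝ :=
  G + 22 * A * ((1 - ε) / ε) + 18 * tauTilde ε * Real.sqrt A + N * ((1 - ε) / ε) / Real.log 2

theorem integral_regret_thresholdFamily_le {ε A G : ℝ} {N : ℕ} (hε0 : 0 < ε) (hε1 : ε < 1)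
    (hA : 0 ≤ A) (hG : 0 ≤ G) (I : BanditInstance) (hI : ∀ a x, I.P a x ≤ 1 - ε) (πstar : Policy)
    {H T : ℕ} (hT : 2 ≤ T)
    (hlarge : N ≤ T → 1 ≤ Real.log T ∧ 2 * (H : ℝ) + 2 ≤ A * Real.log T ∧
      ∃ j, T * (expectedReturn I πstar - expectedReturn I (thresholdFamily H j))
        ≤ G * (Real.sqrt T * Real.log T))
    {sel : List ((Category × Fin (H + 1)) × ℕ) → Category × Fin (H + 1)}
    (hsel : IsUCBHybrid T (tauTilde ε) 1 sel) :
    ∫ ω, regret I πstar (thresholdFamily H) sel T ω ∂(streamLaw I)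
      ≤ regretConstant ε A G N * (Real.sqrt T * Real.log T) := by
  have hT2 : (2 : ℝ) ≤ T := by exact_mod_cast hT
  have hlog2 : 0 < Real.log 2 := Real.log_pos (by norm_num)
  have hlogT : Real.log 2 ≤ Real.log T := Real.log_le_log (by norm_num) hT2
  have hsqrt1 : 1 ≤ Real.sqrt T := Real.one_le_sqrt.2 (by linarith)
  have hτ0 : 0 ≤ tauTilde ε := by
    have : 0 < Real.log (1 / (1 - ε)) :=
      Real.log_pos ((one_lt_div (by linarith)).2 (by linarith))
    unfold tauTilde
    positivity
  have hr1 : 1 - ε < 1 := by linarith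
  have hB : (1 - ε) / (1 - (1 - ε)) = (1 - ε) / ε := by rw [sub_sub_cancel]
  set B := (1 - ε) / ε with hBdef
  have hB0 : 0 ≤ B := div_nonneg (by linarith) hε0.le
  set Y := Real.sqrt T * Real.log T with hY
  have hY0 : 0 ≤ Y := mul_nonneg (by linarith) (by linarith)
  have hYlog : Real.log 2 ≤ Y := by nlinarith
  have hC : regretConstant ε A G N * Y = G * Y + 22 * A * B * Y
      + 18 * tauTilde ε * Real.sqrt A * Y + N * B * (Y / Real.log 2) := by
    unfold regretConstant
    ring
  rw [hC]
  have n1 : 0 ≤ G * Y := by positivity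
  have n2 : 0 ≤ 22 * A * B * Y := by positivity
  have n3 : 0 ≤ 18 * tauTilde ε * Real.sqrt A * Y := by positivity
  have n4 : 0 ≤ N * B * (Y / Real.log 2) := by positivity
  by_cases hN : N ≤ T
  swap
  · push Not at hN
    have h1 := integral_regret_le_mul I hI hr1 πstar (thresholdFamily H) sel T
    rw [hB] at h1
    have h2 : (T : ℝ) * B ≤ N * B := by gcongr
    have h3 : 1 ≤ Y / Real.log 2 := (one_le_div hlog2).2 hYlog
    have h4 := mul_le_mul_of_nonneg_left h3 (by positivity : 0 ≤ (N : ℝ) * B)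
    linarith
  obtain ⟨hlog1, hcard, j, hj⟩ := hlarge hN
  have hK : (Fintype.card (Category × Fin (H + 1)) : ℝ) = 2 * H + 2 := by
    simp; ring
  have hmain := integral_regret_le I hI hr1 (τ := tauTilde ε) (B := B) rfl hB.symm πstar
    (thresholdFamily H) hT hsel j
  rw [hK] at hmain
  set l := Real.log T with hl
  set K : ℝ := 2 * (H : ℝ) + 2 with hKdef
  have hK0 : 0 ≤ K := by positivity
  have hlsqrt : l ≤ 2 * Real.sqrt T := by
    have h1 : l = 2 * Real.log (Real.sqrt T) := by rw [Real.log_sqrt (by linarith)]; ring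
    have h2 := Real.log_le_sub_one_of_pos (x := Real.sqrt T) (by linarith)
    linarith
  have e1 : K * (B * (8 * l + 2)) ≤ 20 * A * B * Y := by
    calc K * (B * (8 * l + 2)) ≤ (A * l) * (B * (10 * (2 * Real.sqrt T))) := by
          gcongr; linarith
      _ = _ := by rw [hY]; ring
  have e2 : 2 * K * B ≤ 2 * A * B * Y := by
    have : K ≤ A * Y := hcard.trans (by
      gcongr; rw [hY]; nlinarith)
    nlinarith
  have e3 : 6 * (Real.sqrt (8 * tauTilde ε ^ 2 * l) * Real.sqrt (K * T))
      ≤ 18 * tauTilde ε * Real.sqrt A * Y := by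
    have h1 : Real.sqrt (8 * tauTilde ε ^ 2 * l) ≤ 3 * tauTilde ε * Real.sqrt l := by
      rw [← Real.sqrt_sq (by positivity : 0 ≤ 3 * tauTilde ε * Real.sqrt l)]
      refine Real.sqrt_le_sqrt ?_
      rw [mul_pow, Real.sq_sqrt (by linarith), mul_pow]
      have : 0 ≤ tauTilde ε ^ 2 * l := by positivity
      linarith
    have h2 : Real.sqrt (K * T) ≤ Real.sqrt A * Real.sqrt l * Real.sqrt T := by
      rw [← Real.sqrt_mul hA, ← Real.sqrt_mul (by positivity)]
      exact Real.sqrt_le_sqrt (by gcongr)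
    calc 6 * (Real.sqrt (8 * tauTilde ε ^ 2 * l) * Real.sqrt (K * T))
        ≤ 6 * ((3 * tauTilde ε * Real.sqrt l) * (Real.sqrt A * Real.sqrt l * Real.sqrt T)) := by
          gcongr
      _ = 18 * tauTilde ε * Real.sqrt A * (Real.sqrt T * (Real.sqrt l * Real.sqrt l)) := by ring
      _ = _ := by rw [Real.mul_self_sqrt (by linarith)]
  linarith

theorem eventually_card_le {H : ℕ → ℕ}
    (hH : (fun T : ℕ => (H T : ℝ)) =O[atTop] fun T : ℕ => Real.log T) :
    ∃ A, 0 ≤ A ∧ ∀ᶠ T : ℕ in atTop,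
      1 ≤ Real.log T ∧ 2 * (H T : ℝ) + 2 ≤ A * Real.log T := by
  obtain ⟨c, hc0, hc⟩ := hH.exists_nonneg
  refine ⟨2 * c + 2, by positivity, ?_⟩
  have hlog : Tendsto (fun T : ℕ => Real.log T) atTop atTop :=
    Real.tendsto_log_atTop.comp tendsto_natCast_atTop_atTop
  filter_upwards [hc.bound, hlog.eventually_ge_atTop 1] with T h1 h2
  refine ⟨h2, ?_⟩
  rw [Real.norm_natCast, Real.norm_of_nonneg (by linarith)] at h1
  linarith

theorem mul_pow_le_sqrt {ε : ℝ} (hε0 : 0 < ε) (hε1 : ε < 1) {H T : ℕ} (hT : 1 ≤ T)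
    (hHT : Real.log T ≤ 2 * Real.log (1 / (1 - ε)) * H) :
    T * ((1 - ε) ^ H / (1 - (1 - ε))) ≤ 1 / ε * Real.sqrt T := by
  have hT0 : (0 : ℝ) < T := by exact_mod_cast hT
  have hsq : 0 < Real.sqrt T := Real.sqrt_pos.2 hT0
  have hpow : (1 - ε) ^ H ≤ (Real.sqrt T)⁻¹ := by
    rw [← Real.log_le_log_iff (by have : 0 < 1 - ε := by linarith
                                  positivity) (by positivity), Real.log_pow, Real.log_inv,
      Real.log_sqrt hT0.le]
    rw [one_div, Real.log_inv] at hHT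
    linarith
  rw [sub_sub_cancel]
  calc T * ((1 - ε) ^ H / ε) ≤ T * ((Real.sqrt T)⁻¹ / ε) := by gcongr
    _ = 1 / ε * (T / Real.sqrt T) := by ring
    _ = _ := by rw [Real.div_sqrt]

end DepartingBandits

theorem mainTheorem1 (ε : ℝ) (hε0 : 0 < ε) (hε1 : ε < 1) :
    -- returns are integrable, and an optimal policy exists
    (∀ I : DepartingBandits.BanditInstance, (∀ a x, I.P a x ≤ 1 - ε) →
      (∀ π : DepartingBandits.Policy,
        Integrable (fun u => (DepartingBandits.policyReturn π u.2 : ℝ))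
          (DepartingBandits.userLaw I)) ∧
      ∃ πstar : DepartingBandits.Policy, DepartingBandits.IsOptimal I πstar) ∧
    -- if `H` is a large enough multiple of `ln T`, the bound is uniform over the instances
    (∀ H : ℕ → ℕ,
      (fun T : ℕ => (H T : ℝ)) =Θ[atTop] (fun T : ℕ => Real.log T) →
      (∀ᶠ T : ℕ in atTop, Real.log T ≤ 2 * Real.log (1 / (1 - ε)) * H T) →
      ∃ C : ℝ, ∀ I : DepartingBandits.BanditInstance, (∀ a x, I.P a x ≤ 1 - ε) →
        ∀ πstar : DepartingBandits.Policy, DepartingBandits.IsOptimal I πstar →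
        ∀ T : ℕ, 2 ≤ T →
        ∀ sel : List ((DepartingBandits.Category × Fin (H T + 1)) × ℕ) →
            DepartingBandits.Category × Fin (H T + 1),
          DepartingBandits.IsUCBHybrid T (DepartingBandits.tauTilde ε) 1 sel →
          Integrable (DepartingBandits.regret I πstar
              (DepartingBandits.thresholdFamily (H T)) sel T) (DepartingBandits.streamLaw I) ∧
          ∫ ω, DepartingBandits.regret I πstar
              (DepartingBandits.thresholdFamily (H T)) sel T ω ∂(DepartingBandits.streamLaw I)
            ≤ C * (Real.sqrt T * Real.log T)) ∧
    -- for every `H` of order `ln T`, the bound holds on each instance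
    (∀ H : ℕ → ℕ,
      (fun T : ℕ => (H T : ℝ)) =Θ[atTop] (fun T : ℕ => Real.log T) →
      ∀ I : DepartingBandits.BanditInstance, (∀ a x, I.P a x ≤ 1 - ε) →
      ∃ C : ℝ,
        ∀ πstar : DepartingBandits.Policy, DepartingBandits.IsOptimal I πstar →
        ∀ T : ℕ, 2 ≤ T →
        ∀ sel : List ((DepartingBandits.Category × Fin (H T + 1)) × ℕ) →
            DepartingBandits.Category × Fin (H T + 1),
          DepartingBandits.IsUCBHybrid T (DepartingBandits.tauTilde ε) 1 sel →
          Integrable (DepartingBandits.regret I πstar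
              (DepartingBandits.thresholdFamily (H T)) sel T) (DepartingBandits.streamLaw I) ∧
          ∫ ω, DepartingBandits.regret I πstar
              (DepartingBandits.thresholdFamily (H T)) sel T ω ∂(DepartingBandits.streamLaw I)
            ≤ C * (Real.sqrt T * Real.log T)) := by
  have hr1 : 1 - ε < 1 := by linarith
  refine ⟨fun I hI => ⟨DepartingBandits.integrable_policyReturn I hI hr1, ?_⟩, ?_, ?_⟩
  · obtain ⟨a, h, hah⟩ := DepartingBandits.exists_isOptimal_threshold I hI hr1
    exact ⟨_, hah⟩
  · intro H hH hlow
    obtain ⟨A, hA, hev⟩ := DepartingBandits.eventually_card_le hH.1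
    obtain ⟨N, hN⟩ := eventually_atTop.1 (hev.and hlow)
    refine ⟨DepartingBandits.regretConstant ε A (1 / ε) N, ?_⟩
    intro I hI πstar _ T hT sel hsel
    refine ⟨(DepartingBandits.integrable_regret I hI hr1 πstar _ sel T).1, ?_⟩
    refine DepartingBandits.integral_regret_thresholdFamily_le hε0 hε1 hA (by positivity) I hI
      πstar hT (fun hNT => ?_) hsel
    obtain ⟨⟨hlog, hcard⟩, hHT⟩ := hN T hNT
    refine ⟨hlog, hcard, ?_⟩
    obtain ⟨j, hj⟩ := DepartingBandits.exists_thresholdFamily_ge I hI hr1 πstar (H T)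
    refine ⟨j, ?_⟩
    calc _ ≤ T * ((1 - ε) ^ H T / (1 - (1 - ε))) := by gcongr; linarith
      _ ≤ 1 / ε * Real.sqrt T := DepartingBandits.mul_pow_le_sqrt hε0 hε1 (by omega) hHT
      _ ≤ 1 / ε * (Real.sqrt T * Real.log T) := by
        gcongr; exact le_mul_of_one_le_right (Real.sqrt_nonneg _) hlog
  · intro H hH I hI
    obtain ⟨A, hA, hev⟩ := DepartingBandits.eventually_card_le hH.1
    obtain ⟨a, h, hopt⟩ := DepartingBandits.exists_isOptimal_threshold I hI hr1
    have hHtop : Tendsto (fun T : ℕ => (H T : ℝ)) atTop atTop := by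
      have hlog : Tendsto (fun T : ℕ => ‖Real.log T‖) atTop atTop :=
        tendsto_norm_atTop_atTop.comp (Real.tendsto_log_atTop.comp tendsto_natCast_atTop_atTop)
      simpa only [Function.comp_def, Real.norm_natCast] using hH.tendsto_norm_atTop_iff.2 hlog
    obtain ⟨N, hN⟩ := eventually_atTop.1 (hev.and (hHtop.eventually_ge_atTop (h : ℝ)))
    refine ⟨DepartingBandits.regretConstant ε A 0 N, ?_⟩
    intro πstar _ T hT sel hsel
    refine ⟨(DepartingBandits.integrable_regret I hI hr1 πstar _ sel T).1, ?_⟩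
    refine DepartingBandits.integral_regret_thresholdFamily_le hε0 hε1 hA le_rfl I hI
      πstar hT (fun hNT => ?_) hsel
    obtain ⟨⟨hlog, hcard⟩, hhH⟩ := hN T hNT
    have hhH' : h ≤ H T := by exact_mod_cast hhH
    refine ⟨hlog, hcard, (a, ⟨h, by omega⟩), ?_⟩
    rw [zero_mul]
    exact mul_nonpos_of_nonneg_of_nonpos (Nat.cast_nonneg T) (sub_nonpos.2 (hopt πstar))
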